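/- Let $m\ge 1$ and $n\ge 0$ be integers. For $\lambda\in\mathbb C$ let $H_\lambda=\mathbb C[h_{-1},h_{-2},\dots]\,|\lambda\rangle$ be the Fock module of the Heisenberg algebra $[h_i,h_j]=i\,\delta_{i+j,0}$ with $h_0|\lambda\rangle=\lambda|\lambda\rangle$ and $h_i|\lambda\rangle=0$ for $i>0$. On $L=\bigoplus_{j\in\mathbb Z}H_{j/\sqrt{2m}}$ (the sum of the irreducible modules of the lattice vertex algebra of $\mathbb Zl$, $\langle l,l\rangle=2m$) consider the vertex operator $$\phi_{\sqrt{2m}}(z)=\sum_{i\in\mathbb Z}a_iz^{-i-1}=e^{\sqrt{2m}\,Q}\,z^{\sqrt{2m}\,h_0}\exp\Big(\sqrt{2m}\sum_{i\ge1}\frac{h_{-i}}{i}z^{i}\Big)\exp\Big(-\sqrt{2m}\sum_{i\ge1}\frac{h_i}{i}z^{-i}\Big),$$ where $e^{\sqrt{2m}\,Q}$ commutes with $h_i$, $i\neq0$, and maps $|\lambda\rangle$ to $|\lambda+\sqrt{2m}\rangle$, and the operator $$L_0=\tfrac12h_0^2+\sum_{i\ge1}h_{-i}h_i-\frac{m-1}{\sqrt{2m}}h_0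 .$$ Let $v_p=|\tfrac{-p}{\sqrt{2m}}\rangle$ for $p\in\mathbb Z$, so that $$h_0v_p=(\deg_zv_p)\,v_p,\quad \deg_zv_p=\tfrac{-p}{\sqrt{2m}},\qquad L_0v_p=(\deg_qv_p)\,v_p,\quad \deg_qv_p=\tfrac{p^2}{4m}+\tfrac{p(m-1)}{2m}.$$ Let $V_{(m)}=\mathbb C[a_{-m},a_{-m-1},\dots]\cdot v_{1-m}$ and $$C_{(m)}(n)=V_{(m)}\big/\operatorname{span}\{a_iV_{(m)}:\ i\le -m-n\}.$$ Define $F^{(2m)}_i=i+1$ for $0\le i\le 2m-1$ and $F^{(2m)}_{i+2m}=F^{(2m)}_{i+2m-1}+F^{(2m)}_i$ for $i\ge 0$. Let $\begin{bmatrix}N\\k\end{bmatrix}=\frac{(1-q)\cdots(1-q^N)}{(1-q)\cdots(1-q^k)\,(1-q)\cdots(1-q^{N-k})}$ for $0\le k\le N$, and $\begin{bmatrix}N\\k\end{bmatrix}=0$ for all integers $N<k$, negative ones included. Then: a) $C_{(m)}(n)$ is finite-dimensional, and $\dim C_{(m)}(n)=F^{(2m)}_n$. b) $C_{(m)}(n)$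 inherits from $V_{(m)}$ the bigrading by the eigenvalues of $h_0$ ($z$-degree) and $L_0$ ($q$-degree): it is the direct sum of the images of the joint eigenspaces of $h_0,L_0$ in $V_{(m)}$. Its character $\mathrm{ch}(z,q,C_{(m)}(n))=\operatorname{Tr}\big(z^{h_0}q^{L_0}|_{C_{(m)}(n)}\big)$, as a formal combination of the symbols $z^xq^y$, is $$\mathrm{ch}(z,q,C_{(m)}(n))=z^{\deg_zv_{1-m}}\,q^{\deg_qv_{1-m}}\sum_{k\ge0}z^{k\sqrt{2m}}\,q^{mk^2}\begin{bmatrix}n-(2m-1)(k-1)\\k\end{bmatrix}.$$ -/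

import Mathlib

noncomputable section

namespace LatticeVertex

open Finset MvPolynomial

/-! ### Locally finite sums and formal exponentials of operators -/

/-- The sum of a family of operators `T i` such that, for every vector `v`, only finitely many of
the vectors `T i v` are nonzero. -/
def locSum {ι E : Type*} [AddCommGroup E] [Module ℂ E] (T : ι → Module.End ℂ E)
    (hT : ∀ v, (Function.support fun i => T i v).Finite) : Module.End ℂ E where
  toFun v := ∑ᶠ i, T i v
  map_add' v w := by
    simp only [map_add]
    exact finsum_add_distrib (hT v) (hT w)
  map_smul' c v := by
    simp only [map_smul, RingHom.id_apply]
    exact (smul_finsum' c (hT v)).symm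

/-- The coefficient at `t ^ N` of `exp (S t) = ∑ r, (S t) ^ r / r!`, for a formal power series `S`
without constant term over a `ℂ`-algebra (the terms with `r > N` do not contribute to it). -/
def expCoeff {A : Type*} [Ring A] [Algebra ℂ A] (S : PowerSeries A) (N : ℕ) : A :=
  ∑ r ∈ range (N + 1), ((r.factorial : ℂ)⁻¹) • PowerSeries.coeff N (S ^ r)

/-! ### The Fock space -/

/-- The underlying space of each Fock space `H_lam`: polynomials in `h_{-1}, h_{-2}, …` applied
to the highest weight vector `|lam⟩`.  The variable `X k` is `h_{-(k+1)}`, and `1` is `|lam⟩`. -/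
abbrev Fock : Type := MvPolynomial ℕ ℂ

/-- The creation operator `h_{-(k+1)}`: multiplication by the variable `h_{-(k+1)}`. -/
def create (k : ℕ) : Module.End ℂ Fock := LinearMap.mulLeft ℂ (X k)

/-- The annihilation operator `h_{k+1} = (k+1) ∂/∂h_{-(k+1)}`. -/
def annih (k : ℕ) : Module.End ℂ Fock :=
  ((k : ℂ) + 1) • ((pderiv k : Derivation ℂ Fock Fock) : Fock →ₗ[ℂ] Fock)

/-- The polynomials all of whose monomials have degree `< d`, where `h_{-i}` has degree `i`. -/
def lowDegree (d : ℕ) : Submodule ℂ Fock :=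
  Submodule.span ℂ {f | ∃ e : ℕ →₀ ℕ, Finsupp.weight (fun k : ℕ => k + 1) e < d ∧
    f = monomial e (1 : ℂ)}

theorem lowDegree_mono {d d' : ℕ} (h : d ≤ d') : lowDegree d ≤ lowDegree d' :=
  Submodule.span_mono fun _ ⟨e, he, hf⟩ => ⟨e, lt_of_lt_of_le he h, hf⟩

theorem exists_mem_lowDegree (f : Fock) : ∃ d, f ∈ lowDegree d := by
  induction f using MvPolynomial.induction_on' with
  | monomial e c =>
    refine ⟨Finsupp.weight (fun k : ℕ => k + 1) e + 1, ?_⟩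
    have h : monomial e c = c • monomial e (1 : ℂ) := by simp [smul_monomial]
    rw [h]
    exact Submodule.smul_mem _ _ (Submodule.subset_span ⟨e, Nat.lt_succ_self _, rfl⟩)
  | add p q hp hq =>
    obtain ⟨d, hd⟩ := hp
    obtain ⟨d', hd'⟩ := hq
    exact ⟨max d d', Submodule.add_mem _ (lowDegree_mono (le_max_left _ _) hd)
      (lowDegree_mono (le_max_right _ _) hd')⟩

theorem annih_mem (k d : ℕ) (f : Fock) (hf : f ∈ lowDegree d) :
    annih k f ∈ lowDegree (d - (k + 1)) := by
  induction hf using Submodule.span_induction with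
  | mem f hf =>
    obtain ⟨e, he, rfl⟩ := hf
    by_cases h : e k = 0
    · simp [annih, pderiv_monomial, h]
    · have hk : Finsupp.weight (fun k : ℕ => k + 1) e
          = Finsupp.weight (fun k : ℕ => k + 1) (e - Finsupp.single k 1) + (k + 1) := by
        conv_lhs => rw [← Finsupp.sub_add_single_one_cancel h]
        rw [map_add, Finsupp.weight_single]
        simp
      have h2 : annih k (monomial e (1 : ℂ))
          = (((k : ℂ) + 1) * (e k : ℂ)) • monomial (e - Finsupp.single k 1) (1 : ℂ) := by
        simp [annih, pderiv_monomial, smul_monomial]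
      rw [h2]
      exact Submodule.smul_mem _ _ (Submodule.subset_span ⟨_, by omega, rfl⟩)
  | zero => simp
  | add x y _ _ hx hy => rw [map_add]; exact Submodule.add_mem _ hx hy
  | smul c x _ hx => rw [map_smul]; exact Submodule.smul_mem _ _ hx

theorem expCoeff_annih_mem (c : ℕ → ℂ) (s d : ℕ) (f : Fock) (hf : f ∈ lowDegree d) :
    expCoeff (A := Module.End ℂ Fock) (PowerSeries.mk fun i : ℕ => match i with
      | 0 => 0
      | k + 1 => c k • annih k) s f ∈ lowDegree (d - s) := by
  set S : PowerSeries (Module.End ℂ Fock) := PowerSeries.mk fun i : ℕ => match i with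
      | 0 => (0 : Module.End ℂ Fock)
      | k + 1 => c k • annih k with hS
  have h1 : ∀ (i d : ℕ) (f : Fock), f ∈ lowDegree d →
      PowerSeries.coeff i S f ∈ lowDegree (d - i) := by
    intro i d f hf
    rw [hS, PowerSeries.coeff_mk]
    cases i with
    | zero => simp
    | succ k => exact Submodule.smul_mem _ _ (annih_mem k d f hf)
  have h2 : ∀ (r i d : ℕ) (f : Fock), f ∈ lowDegree d →
      PowerSeries.coeff i (S ^ r) f ∈ lowDegree (d - i) := by
    intro r
    induction r with
    | zero =>
      intro i d f hf
      rw [pow_zero, PowerSeries.coeff_one]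
      by_cases h : i = 0
      · simpa [h] using hf
      · simp [h]
    | succ r ih =>
      intro i d f hf
      rw [pow_succ, PowerSeries.coeff_mul, LinearMap.sum_apply]
      refine Submodule.sum_mem _ fun p hp => ?_
      have h3 := ih p.1 _ _ (h1 p.2 d f hf)
      rw [HasAntidiagonal.mem_antidiagonal] at hp
      rwa [Nat.sub_sub, add_comm, hp] at h3
  rw [expCoeff, LinearMap.sum_apply]
  exact Submodule.sum_mem _ fun r _ => Submodule.smul_mem _ _ (h2 r s d f hf)

/-! ### The vertex operator -/

/-- The number `√(2m)`. -/
def sqrtTwo (m : ℕ) : ℂ := ((Real.sqrt (2 * m) : ℝ) : ℂ)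

/-- The operators `E₊_t`, where
`∑ t, E₊_t z ^ t = exp (√(2m) ∑_{i ≥ 1} h_{-i} z ^ i / i)`. -/
def expCreate (m : ℕ) (t : ℕ) : Module.End ℂ Fock :=
  expCoeff (PowerSeries.mk fun i : ℕ => match i with
    | 0 => (0 : Module.End ℂ Fock)
    | k + 1 => (sqrtTwo m / ((k : ℂ) + 1)) • create k) t

/-- The operators `E₋_s`, where
`∑ s, E₋_s z ^ (-s) = exp (-√(2m) ∑_{i ≥ 1} h_i z ^ (-i) / i)`. -/
def expAnnih (m : ℕ) (s : ℕ) : Module.End ℂ Fock :=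
  expCoeff (PowerSeries.mk fun i : ℕ => match i with
    | 0 => (0 : Module.End ℂ Fock)
    | k + 1 => (-(sqrtTwo m / ((k : ℂ) + 1))) • annih k) s

theorem expAnnih_finite (m : ℕ) (f : Fock) :
    (Function.support fun s => expAnnih m s f).Finite := by
  obtain ⟨d, hd⟩ := exists_mem_lowDegree f
  refine (Set.finite_lt_nat d).subset fun s hs => ?_
  by_contra h
  have h1 := expCoeff_annih_mem (fun k => -(sqrtTwo m / ((k : ℂ) + 1))) s d f hd
  rw [Nat.sub_eq_zero_of_le (by simpa using h)] at h1
  apply hs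
  simpa [lowDegree, expAnnih] using h1

/-- The coefficient of `z ^ N` in
`exp (√(2m) ∑_{i ≥ 1} h_{-i} z ^ i / i) * exp (-√(2m) ∑_{i ≥ 1} h_i z ^ (-i) / i)`. -/
def vertexCoeff (m : ℕ) (N : ℤ) : Module.End ℂ Fock :=
  locSum (fun s : ℕ => if 0 ≤ N + s then expCreate m (N + s).toNat * expAnnih m s else 0) (by
    intro f
    refine (expAnnih_finite m f).subset fun s hs h => hs ?_
    have h' : expAnnih m s f = 0 := h
    by_cases h0 : 0 ≤ N + s <;> simp [h0, h'])

/-- The direct sum of the irreducible modules `L_{(m),i}`, `0 ≤ i < 2m`, of the lattice vertex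
algebra: the direct sum of the Fock spaces `H_{j/√(2m)}` over `j ∈ ℤ`. -/
def Total : Type := ℤ →₀ Fock

instance : AddCommGroup Total := inferInstanceAs (AddCommGroup (ℤ →₀ Fock))

instance : Module ℂ Total := inferInstanceAs (Module ℂ (ℤ →₀ Fock))

/-- The inclusion of `H_{j/√(2m)}` into the direct sum. -/
def incl (j : ℤ) : Fock →ₗ[ℂ] Total := (Finsupp.lsingle j : Fock →ₗ[ℂ] (ℤ →₀ Fock))

/-- The linear operator given by `T j` on the summand `H_{j/√(2m)}`. -/
def onSummands (T : ℤ → Fock →ₗ[ℂ] Total) : Module.End ℂ Total :=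
  (Finsupp.lsum ℂ T : (ℤ →₀ Fock) →ₗ[ℂ] Total)

theorem onSummands_incl (T : ℤ → Fock →ₗ[ℂ] Total) (j : ℤ) (f : Fock) :
    onSummands T (incl j f) = T j f := by
  have h : (Finsupp.lsum ℂ T : (ℤ →₀ Fock) →ₗ[ℂ] Total) (Finsupp.single j f) = T j f := by simp
  exact h

/-- The Fourier coefficient `a_n` of the vertex operator
`φ(z) = ∑ a_n z ^ (-n-1)
  = e ^ {√(2m) Q} z ^ {√(2m) h_0} exp (√(2m) ∑_{i ≥ 1} h_{-i} z ^ i / i)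
      exp (-√(2m) ∑_{i ≥ 1} h_i z ^ (-i) / i)`,
where `e ^ {√(2m) Q} |lam⟩ = |lam + √(2m)⟩`.  On `H_{j/√(2m)}` the operator `z ^ {√(2m) h_0}` is
multiplication by `z ^ j`, and `e ^ {√(2m) Q}` maps this space to `H_{(j+2m)/√(2m)}`. -/
def a (m : ℕ) (n : ℤ) : Module.End ℂ Total :=
  onSummands fun j : ℤ => incl (j + 2 * m) ∘ₗ vertexCoeff m (-n - 1 - j)

/-- The extremal vector `v_p = |-p/√(2m)⟩`. -/
def v (p : ℤ) : Total := incl (-p) 1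

/-! ### The two gradings -/

/-- The operator `h_0`: the scalar `j/√(2m)` on `H_{j/√(2m)}`. -/
def h0 (m : ℕ) : Module.End ℂ Total :=
  onSummands fun j : ℤ => ((j : ℂ) / sqrtTwo m) • incl j

/-- The operator `∑_{i ≥ 1} h_{-i} h_i` on a Fock space. -/
def fockEnergy : Module.End ℂ Fock :=
  locSum (fun k : ℕ => create k * annih k) (by
    intro f
    refine f.vars.finite_toSet.subset fun k hk => ?_
    by_contra h
    exact hk (by simp [annih, pderiv_eq_zero_of_notMem_vars (by simpa using h)]))

/-- The Virasoro operator `L_0 = (1/2) ∑_{i+j=0} :h_i h_j: - ((m-1)/√(2m)) h_0`, that is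
`h_0²/2 + ∑_{i ≥ 1} h_{-i} h_i - ((m-1)/√(2m)) h_0`. -/
def L0 (m : ℕ) : Module.End ℂ Total :=
  (1 / 2 : ℂ) • (h0 m * h0 m) + onSummands (fun j : ℤ => incl j ∘ₗ fockEnergy)
    - (((m : ℂ) - 1) / sqrtTwo m) • h0 m

/-- `deg_z v_p`, the `h_0`-eigenvalue of `v_p`. -/
def degZ (m : ℕ) (p : ℤ) : ℂ := -(p : ℂ) / sqrtTwo m

/-- `deg_q v_p`, the `L_0`-eigenvalue of `v_p`. -/
def degQ (m : ℕ) (p : ℤ) : ℂ :=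
  (p : ℂ) ^ 2 / (4 * m) + (p : ℂ) * ((m : ℂ) - 1) / (2 * m)

theorem sqrtTwo_mul_self (m : ℕ) : sqrtTwo m * sqrtTwo m = 2 * m := by
  unfold sqrtTwo
  rw [← Complex.ofReal_mul, Real.mul_self_sqrt (by positivity)]
  push_cast
  ring

theorem h0_v (m : ℕ) (p : ℤ) : h0 m (v p) = degZ m p • v p := by
  simp [h0, v, degZ, onSummands_incl]

theorem L0_v (m : ℕ) (hm : 1 ≤ m) (p : ℤ) : L0 m (v p) = degQ m p • v p := by
  have hE : fockEnergy (1 : Fock) = 0 := by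
    change ∑ᶠ k : ℕ, (create k * annih k) (1 : Fock) = 0
    simp [annih]
  have hs := sqrtTwo_mul_self m
  have hs0 : sqrtTwo m ≠ 0 := by
    intro h
    rw [h] at hs
    have : (m : ℂ) ≠ 0 := by exact_mod_cast (by omega : m ≠ 0)
    simp_all
  have hm0 : (m : ℂ) ≠ 0 := by exact_mod_cast (by omega : m ≠ 0)
  have hv : onSummands (fun j : ℤ => incl j ∘ₗ fockEnergy) (v p) = 0 := by
    simp [v, onSummands_incl, hE]
  simp only [L0, LinearMap.sub_apply, LinearMap.add_apply, LinearMap.smul_apply,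
    Module.End.mul_apply, h0_v, map_smul, hv, add_zero, smul_smul, ← sub_smul]
  congr 1
  have hm' : (m : ℂ) = sqrtTwo m * sqrtTwo m / 2 := by rw [hs]; ring
  rw [degZ, degQ]
  have e1 : (4 * m : ℂ) = 2 * (sqrtTwo m * sqrtTwo m) := by rw [hs]; ring
  rw [e1, ← hs]
  field_simp
  ring

/-- The vectors of bidegree `e = (e₁, e₂)`: `h_0 w = e₁ w` and `L_0 w = e₂ w`. -/
def bidegree (m : ℕ) (e : ℂ × ℂ) : Submodule ℂ Total :=
  (h0 m).eigenspace e.1 ⊓ (L0 m).eigenspace e.2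

/-! ### The principal subspace and its coinvariants -/

/-- The principal subspace `V_{(m),p} = ℂ[a_{p-1}, a_{p-2}, …] v_p`. -/
def principal (m : ℕ) (p : ℤ) : Submodule ℂ Total :=
  (Subalgebra.toSubmodule (Algebra.adjoin ℂ {T | ∃ i : ℤ, i ≤ p - 1 ∧ T = a m i})).map
    (LinearMap.applyₗ (v p))

/-- `V_{(m)} = V_{(m),1-m} = ℂ[a_{-m}, a_{-m-1}, …] v_{1-m}`. -/
abbrev V (m : ℕ) : Submodule ℂ Total := principal m (1 - m)

/-- The span of the subspaces `a_i V_{(m)}`, `i ≤ -m-n`, as a subspace of `V_{(m)}`. -/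
def coinvariantKernel (m n : ℕ) : Submodule ℂ (V m) :=
  (⨆ i : {i : ℤ // i ≤ -(m : ℤ) - n}, (V m).map (a m i)).comap (V m).subtype

/-- The `a_i V_{(m)}` in question are contained in `V_{(m)}`, so that the passage to subspaces of
`V_{(m)}` in `coinvariantKernel` loses nothing. -/
theorem iSup_map_a_le (m n : ℕ) :
    (⨆ i : {i : ℤ // i ≤ -(m : ℤ) - n}, (V m).map (a m i)) ≤ V m := by
  refine iSup_le fun i => ?_
  rintro _ ⟨_, ⟨T, hT, rfl⟩, rfl⟩
  refine ⟨a m i * T, Subalgebra.mul_mem _ (Algebra.subset_adjoin ⟨i, ?_, rfl⟩) hT, rfl⟩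
  have := i.2
  omega

/-- The coinvariants `C_{(m)}(n) = V_{(m)} / span {a_i V_{(m)}, i ≤ -m-n}`. -/
abbrev Coinv (m n : ℕ) : Type := V m ⧸ coinvariantKernel m n

/-- The component of bidegree `e` of the bigrading that `C_{(m)}(n)` inherits from `V_{(m)}`: the
image of the vectors of bidegree `e` in `V_{(m)}`. -/
def coinvPiece (m n : ℕ) (e : ℂ × ℂ) : Submodule ℂ (Coinv m n) :=
  ((bidegree m e).comap (V m).subtype).map (coinvariantKernel m n).mkQ

/-! ### Numbers and characters -/

/-- `F^{(M)}_i = i + 1` for `0 ≤ i ≤ M - 1`, `F^{(M)}_{i+M} = F^{(M)}_{i+M-1} + F^{(M)}_i`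
(for `M ≥ 1`). -/
def F (M : ℕ) (i : ℕ) : ℕ :=
  if _h : i < M ∨ M = 0 then i + 1 else F M (i - 1) + F M (i - M)
termination_by i

theorem F_init (M i : ℕ) (h : i < M) : F M i = i + 1 := by
  rw [F]; simp [h]

theorem F_add (M i : ℕ) (hM : 1 ≤ M) : F M (i + M) = F M (i + M - 1) + F M i := by
  rw [F]
  simp [show M ≠ 0 by omega]

/-- The Gaussian binomial coefficient as a polynomial in `q`, by the `q`-Pascal rule. -/
def qBinom : ℕ → ℕ → Polynomial ℤ
  | _, 0 => 1
  | 0, _ + 1 => 0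
  | N + 1, k + 1 => qBinom N k + Polynomial.X ^ (k + 1) * qBinom N (k + 1)

/-- `(1-q)(1-q²)⋯(1-q^N)`. -/
def qPoch (N : ℕ) : Polynomial ℤ := ∏ i ∈ range N, (1 - Polynomial.X ^ (i + 1))

theorem qBinom_of_lt (N k : ℕ) (h : N < k) : qBinom N k = 0 := by
  induction N generalizing k with
  | zero => obtain ⟨k, rfl⟩ := Nat.exists_eq_succ_of_ne_zero (by omega : k ≠ 0); rfl
  | succ N ih =>
    obtain ⟨k, rfl⟩ := Nat.exists_eq_succ_of_ne_zero (by omega : k ≠ 0)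
    rw [qBinom, ih k (by omega), ih (k + 1) (by omega)]; simp

/-- The usual formula `[N choose k] = (q)_N / ((q)_k (q)_{N-k})`, for `N = k + l`. -/
theorem qBinom_mul (k l : ℕ) : qBinom (k + l) k * (qPoch k * qPoch l) = qPoch (k + l) := by
  induction h : k + l generalizing k l with
  | zero =>
    obtain ⟨rfl, rfl⟩ : k = 0 ∧ l = 0 := by omega
    simp [qBinom, qPoch]
  | succ N ih =>
    cases k with
    | zero =>
      obtain rfl : l = N + 1 := by omega
      simp [qBinom, qPoch]
    | succ k =>
      have hP : ∀ j, qPoch (j + 1) = qPoch j * (1 - Polynomial.X ^ (j + 1)) := fun j => by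
        rw [qPoch, prod_range_succ]; rfl
      have h1 := ih k l (by omega)
      rw [qBinom]
      cases l with
      | zero =>
        obtain rfl : N = k := by omega
        rw [qBinom_of_lt N (N + 1) (by omega), hP]
        linear_combination (1 - Polynomial.X ^ (N + 1)) * h1
      | succ l =>
        have h2 := ih (k + 1) l (by omega)
        obtain rfl : N = k + l + 1 := by omega
        rw [hP (k + l + 1)]
        rw [hP l] at h1 ⊢
        rw [hP k] at h2 ⊢
        linear_combination (1 - Polynomial.X ^ (k + 1)) * h1
          + Polynomial.X ^ (k + 1) * (1 - Polynomial.X ^ (l + 1)) * h2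

/-- The Gaussian binomial coefficient with an integer upper entry, `0` unless `0 ≤ k ≤ N`. -/
def qBinomInt (N : ℤ) (k : ℕ) : Polynomial ℤ := if N < 0 then 0 else qBinom N.toNat k

/-- The ring of finite formal combinations of symbols `z^x q^y`, `x, y ∈ ℂ`. -/
abbrev CharRing : Type := AddMonoidAlgebra ℤ (ℂ × ℂ)

/-- The symbol `z^x q^y`. -/
def zq (x y : ℂ) : CharRing := AddMonoidAlgebra.single (x, y) 1

/-- The character `Tr (z^{h_0} q^{L_0})` of `C_{(m)}(n)`, as the formal sum
`∑_{(x,y)} dim (C_{(m)}(n))_{x,y} z^x q^y`, given by its coefficients. -/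
def ch (m n : ℕ) : ℂ × ℂ → ℤ := fun e => (Module.finrank ℂ (coinvPiece m n e) : ℤ)

/-- `z^{deg_z v_{1-m}} q^{deg_q v_{1-m}}
  ∑_{k ≥ 0} z^{k√(2m)} q^{mk²} [n-(2m-1)(k-1) choose k]`. -/
def chFormula (m n : ℕ) : CharRing :=
  zq (degZ m (1 - m)) (degQ m (1 - m)) *
    ∑ᶠ k : ℕ, zq (k * sqrtTwo m) (m * (k : ℂ) ^ 2) *
      Polynomial.aeval (zq 0 1) (qBinomInt ((n : ℤ) - (2 * m - 1) * ((k : ℤ) - 1)) k)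

end LatticeVertex

end

noncomputable section

namespace LatticeVertex

open Finset MvPolynomial

/-! ### Formal exponentials -/

section ExpCoeff

variable {A : Type*} [Ring A]

/-! Everything is computed in the dual. The principal subspace is spanned by the words a_{-m-r_0} ⋯
a_{-m-r_{k-1}} v_{1-m} (`V_eq_span`), and the subspace factored out by those with k ≥ 1 and r_0 ≥ n
(`iSup_map_a_eq_span`). For fixed k, collect the values of a functional on all words into a power
series in X_0, …, X_{k-1}. The constant-term functional gives the correlation function Δ = ∏_{i<j}
(X_i - X_j)^{2m} (`constantCoeff_fockWord`), and composing a functional with h_j multiplies its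
series by √(2m) p_j, where p_j is a power sum (`hasShift`, `transpose_annih`). Hence the coefficient
functionals give, up to nonzero scalars, the products of power sums times Δ
(`exists_coeff_fockWord`). Power sums generate the symmetric polynomials, so the relations among
words are exactly those satisfied by the coefficients of all gΔ with g symmetric
(`sum_smul_fockWord_eq_zero_iff`).

By duality (`finrank_range_eq_of_relations`) the component of the coinvariants with length k and
exponent sum N has the dimension of the space of symmetric g, homogeneous of degree D = N - mk(k-1),
for which gΔ has no monomial with X_0-exponent at least n. For k ≥ 1, Δ has degree 2m(k-1) in X_0,
so this bounds all exponents of g by n - 2m(k-1) (`bounded_iff`). Such g are counted by partitions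
in a box, that is, by a Gaussian binomial (`card_monoFuns`). The q-degree relative to v_{1-m} is mk
+ N = mk² + D, which gives the character.

The character has finite support, whence finite dimension. Setting z = q = 1 leaves a sum of
ordinary binomials, and Pascal's rule yields the recursion of F^{(2m)} (`sum_choose_eq_F`). -/

theorem coeff_pow_of_lt {S : PowerSeries A} (h0 : PowerSeries.coeff 0 S = 0) :
    ∀ {r N : ℕ}, N < r → PowerSeries.coeff N (S ^ r) = 0 := by
  intro r
  induction r with
  | zero => intro N h; omega
  | succ r ih =>
    intro N h
    rw [pow_succ, PowerSeries.coeff_mul]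
    refine Finset.sum_eq_zero fun p hp => ?_
    rw [HasAntidiagonal.mem_antidiagonal] at hp
    rcases Nat.eq_zero_or_pos p.2 with h2 | h2
    · rw [h2, h0, mul_zero]
    · rw [ih (by omega), zero_mul]

variable [Algebra ℂ A]

theorem expCoeff_eq_sum_range {S : PowerSeries A} (h0 : PowerSeries.coeff 0 S = 0) {N M : ℕ}
    (h : N < M) :
    expCoeff S N = ∑ r ∈ range M, ((r.factorial : ℂ)⁻¹) • PowerSeries.coeff N (S ^ r) := by
  rw [expCoeff]
  refine Finset.sum_subset (range_mono h) fun r _ hr => ?_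
  rw [coeff_pow_of_lt h0 (by simpa using hr), smul_zero]

/-- The commutator of `x` with `S` is the central element c t^(n+1), so commuting with `x` acts on
powers as a derivation: [x, S^(r+1)] = (r+1) c t^(n+1) S^r. -/
theorem mul_coeff_pow {S : PowerSeries A} {x : A} {c : ℂ} {n : ℕ}
    (h : ∀ i, x * PowerSeries.coeff i S
      = PowerSeries.coeff i S * x + if i = n + 1 then c • (1 : A) else 0) (r t : ℕ) :
    x * PowerSeries.coeff t (S ^ (r + 1)) = PowerSeries.coeff t (S ^ (r + 1)) * x
      + if n + 1 ≤ t then ((r + 1 : ℕ) : ℂ) • c • PowerSeries.coeff (t - (n + 1)) (S ^ r) else 0 := by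
  have hS : PowerSeries.C x * S
      = S * PowerSeries.C x + c • (PowerSeries.X ^ (n + 1) : PowerSeries A) := by
    ext i
    rw [PowerSeries.coeff_C_mul, h i, map_add, PowerSeries.coeff_mul_C, PowerSeries.coeff_smul,
      PowerSeries.coeff_X_pow]
    split_ifs <;> simp
  have hX : ∀ T : PowerSeries A, T * (PowerSeries.X ^ (n + 1)) = PowerSeries.X ^ (n + 1) * T :=
    fun T => ((PowerSeries.commute_X T).pow_right (n + 1)).eq
  have key : ∀ r : ℕ, PowerSeries.C x * S ^ (r + 1) = S ^ (r + 1) * PowerSeries.C x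
      + ((r + 1 : ℕ) : ℂ) • c • (PowerSeries.X ^ (n + 1) * S ^ r) := by
    intro r
    induction r with
    | zero => simp [hS]
    | succ r ih =>
      rw [pow_succ, ← mul_assoc, ih, add_mul, mul_assoc, hS, mul_add, ← mul_assoc, ← pow_succ,
        mul_smul_comm, hX, add_assoc]
      congr 1
      rw [smul_mul_assoc, smul_mul_assoc, mul_assoc, ← pow_succ]
      push_cast
      module
  have := congrArg (PowerSeries.coeff t) (key r)
  rw [PowerSeries.coeff_C_mul, map_add, PowerSeries.coeff_mul_C, PowerSeries.coeff_smul,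
    PowerSeries.coeff_smul, PowerSeries.coeff_X_pow_mul'] at this
  rw [this]
  split_ifs <;> simp

/-- Commuting an element past a formal exponential, when it commutes with the exponent up to a
scalar multiple of `t ^ (n + 1)`. -/
theorem mul_expCoeff {S : PowerSeries A} (h0 : PowerSeries.coeff 0 S = 0) {x : A} {c : ℂ} {n : ℕ}
    (h : ∀ i, x * PowerSeries.coeff i S
      = PowerSeries.coeff i S * x + if i = n + 1 then c • (1 : A) else 0) (t : ℕ) :
    x * expCoeff S t = expCoeff S t * x
      + if n + 1 ≤ t then c • expCoeff S (t - (n + 1)) else 0 := by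
  have h1 : expCoeff S t = ∑ r ∈ range (t + 2), ((r.factorial : ℂ)⁻¹) •
      PowerSeries.coeff t (S ^ r) := expCoeff_eq_sum_range h0 (by omega)
  rw [h1, Finset.sum_range_succ', mul_add, add_mul, Finset.mul_sum, Finset.sum_mul]
  have h2 : x * (((0 : ℕ).factorial : ℂ)⁻¹ • PowerSeries.coeff t (S ^ 0))
      = (((0 : ℕ).factorial : ℂ)⁻¹ • PowerSeries.coeff t (S ^ 0)) * x := by
    simp only [pow_zero, PowerSeries.coeff_one]
    split_ifs <;> simp
  rw [h2, add_right_comm]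
  congr 1
  by_cases hn : n + 1 ≤ t
  -- In [x, S^(r+1)] / (r+1)! the factor r+1 cancels, leaving the r-th term of the shifted
  -- exponential.
  · rw [if_pos hn, expCoeff_eq_sum_range h0 (show t - (n + 1) < t + 1 by omega), Finset.smul_sum,
      ← Finset.sum_add_distrib]
    refine Finset.sum_congr rfl fun r _ => ?_
    rw [mul_smul_comm, mul_coeff_pow h, if_pos hn, smul_add, smul_mul_assoc]
    congr 1
    rw [smul_smul, smul_smul, smul_smul]
    congr 1
    have : (r.factorial : ℂ) ≠ 0 := by exact_mod_cast r.factorial_ne_zero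
    have : (r : ℂ) + 1 ≠ 0 := by exact_mod_cast r.succ_ne_zero
    rw [Nat.factorial_succ]
    push_cast
    field_simp
  · rw [if_neg hn, add_zero]
    refine Finset.sum_congr rfl fun r _ => ?_
    rw [mul_smul_comm, mul_coeff_pow h, if_neg hn, add_zero, smul_mul_assoc]

end ExpCoeff

/-! ### Commutation relations -/

theorem annih_create (j k : ℕ) :
    annih j * create k = create k * annih j + if j = k then ((k : ℂ) + 1) • 1 else 0 := by
  refine LinearMap.ext fun f => ?_
  by_cases h : j = k
  · subst h
    simp [annih, create, Derivation.leibniz]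
  · have h1 : pderiv j (X k : Fock) = 0 := pderiv_X_of_ne (Ne.symm h)
    simp [annih, create, Derivation.leibniz, h, h1]

/-- The commutator of two partial derivatives is a derivation that vanishes on the variables. -/
theorem annih_comm (j k : ℕ) : annih j * annih k = annih k * annih j := by
  have h : ⁅(pderiv j : Derivation ℂ Fock Fock), (pderiv k : Derivation ℂ Fock Fock)⁆ = 0 := by
    refine MvPolynomial.derivation_ext fun i => ?_
    rw [Derivation.commutator_apply, pderiv_X, pderiv_X]
    simp [Pi.single_apply]
    split_ifs <;> simp
  refine LinearMap.ext fun f => ?_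
  have h1 := congrArg (fun D => D f) h
  rw [Derivation.commutator_apply] at h1
  simp only [Derivation.zero_apply, sub_eq_zero] at h1
  simp only [annih, Module.End.mul_apply, LinearMap.smul_apply, Derivation.coeFn_coe, map_smul, h1]
  rw [smul_comm]

theorem annih_expAnnih (m j s : ℕ) : annih j * expAnnih m s = expAnnih m s * annih j := by
  refine (mul_expCoeff (x := annih j) (c := 0) (n := 0) ?_ (fun i => ?_) s).trans ?_
  · simp
  · cases i <;> simp [annih_comm]
  · simp [expAnnih]

/-- Only the term √(2m) h_{-(j+1)} z^(j+1) / (j+1) of the exponent fails to commute with h_{j+1},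
and the commutator is the scalar √(2m) z^(j+1). -/
theorem annih_expCreate (m j t : ℕ) : annih j * expCreate m t = expCreate m t * annih j
    + if j + 1 ≤ t then sqrtTwo m • expCreate m (t - (j + 1)) else 0 := by
  refine mul_expCoeff (by simp) (fun i => ?_) t
  cases i with
  | zero => simp
  | succ k =>
    rw [PowerSeries.coeff_mk]
    simp only [mul_smul_comm, smul_mul_assoc, annih_create, smul_add, Nat.succ_inj]
    congr 1
    by_cases h : j = k
    · subst h
      have : (j : ℂ) + 1 ≠ 0 := by exact_mod_cast j.succ_ne_zero
      simp [smul_smul, this]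
    · simp [h, Ne.symm h]

/-- `expCreate` with an integer index, zero for negative ones. -/
def expCreateInt (m : ℕ) (t : ℤ) : Module.End ℂ Fock := if 0 ≤ t then expCreate m t.toNat else 0

theorem annih_expCreateInt (m j : ℕ) (t : ℤ) : annih j * expCreateInt m t
    = expCreateInt m t * annih j + sqrtTwo m • expCreateInt m (t - (j + 1)) := by
  unfold expCreateInt
  by_cases h : 0 ≤ t
  · rw [if_pos h, annih_expCreate]
    congr 1
    by_cases h' : j + 1 ≤ t.toNat
    · rw [if_pos h', if_pos (by omega)]
      congr 2
      omega
    · rw [if_neg h', if_neg (by omega), smul_zero]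
  · rw [if_neg h, if_neg (by omega)]
    simp

theorem vertexCoeff_apply (m : ℕ) (N : ℤ) (f : Fock) {M : ℕ}
    (hM : ∀ s, M ≤ s → expAnnih m s f = 0) :
    vertexCoeff m N f = ∑ s ∈ range M, expCreateInt m (N + s) (expAnnih m s f) := by
  change ∑ᶠ s : ℕ, (if 0 ≤ N + s then expCreate m (N + s).toNat * expAnnih m s else 0) f = _
  have h1 : ∀ s : ℕ, (if 0 ≤ N + s then expCreate m (N + s).toNat * expAnnih m s else 0) f
      = expCreateInt m (N + s) (expAnnih m s f) := by
    intro s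
    unfold expCreateInt
    split_ifs <;> simp
  simp only [h1]
  refine finsum_eq_sum_of_support_subset _ fun s hs => ?_
  by_contra h
  exact hs (by simp [hM s (by simpa using h)])

theorem exists_expAnnih_eq_zero (m : ℕ) (f : Fock) : ∃ M, ∀ s, M ≤ s → expAnnih m s f = 0 := by
  obtain ⟨M, hM⟩ := (expAnnih_finite m f).bddAbove
  refine ⟨M + 1, fun s hs => ?_⟩
  by_contra h
  have := hM h
  omega

/-- Coefficient form of [h_{j+1}, φ(z)] = √(2m) z^(j+1) φ(z): the annihilation half commutes, and
the creation half supplies the scalar. -/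
theorem annih_vertexCoeff (m j : ℕ) (N : ℤ) (f : Fock) :
    annih j (vertexCoeff m N f)
      = vertexCoeff m N (annih j f) + sqrtTwo m • vertexCoeff m (N - (j + 1)) f := by
  obtain ⟨M, hM⟩ := exists_expAnnih_eq_zero m f
  have hc : ∀ s, expAnnih m s (annih j f) = annih j (expAnnih m s f) := fun s =>
    (LinearMap.congr_fun (annih_expAnnih m j s) f).symm
  rw [vertexCoeff_apply m N f hM, vertexCoeff_apply m (N - (j + 1)) f hM,
    vertexCoeff_apply m N (annih j f) (M := M) (fun s hs => by rw [hc, hM s hs, map_zero]),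
    map_sum, Finset.smul_sum, ← Finset.sum_add_distrib]
  refine Finset.sum_congr rfl fun s _ => ?_
  have := LinearMap.congr_fun (annih_expCreateInt m j (N + s)) (expAnnih m s f)
  simp only [Module.End.mul_apply, LinearMap.add_apply, LinearMap.smul_apply] at this
  rw [this, hc]
  congr 4
  ring

theorem constantCoeff_expCreate (m t : ℕ) (f : Fock) :
    constantCoeff (expCreate m t f) = if t = 0 then constantCoeff f else 0 := by
  rw [expCreate, expCoeff, Finset.sum_range_succ', LinearMap.add_apply, LinearMap.sum_apply,
    map_add, map_sum, Finset.sum_eq_zero, zero_add]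
  · simp only [pow_zero, PowerSeries.coeff_one]
    split_ifs <;> simp
  · intro r _
    rw [LinearMap.smul_apply, smul_eq_C_mul, map_mul, pow_succ', PowerSeries.coeff_mul,
      LinearMap.sum_apply, map_sum, Finset.sum_eq_zero, mul_zero]
    rintro ⟨p, p'⟩ _
    cases p with
    | zero => simp
    | succ k => simp [create]

/-- The creation half reaches the constant term only through its z^0 coefficient, so of all summands
only s = -N survives. -/
theorem constantCoeff_vertexCoeff (m : ℕ) (N : ℤ) (f : Fock) :
    constantCoeff (vertexCoeff m N f)
      = if N ≤ 0 then constantCoeff (expAnnih m (-N).toNat f) else 0 := by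
  obtain ⟨M, hM⟩ := exists_expAnnih_eq_zero m f
  rw [vertexCoeff_apply m N f hM, map_sum]
  have h : ∀ s : ℕ, constantCoeff (expCreateInt m (N + s) (expAnnih m s f))
      = if N + s = 0 then constantCoeff (expAnnih m s f) else 0 := by
    intro s
    unfold expCreateInt
    by_cases h0 : 0 ≤ N + s
    · rw [if_pos h0, constantCoeff_expCreate]
      congr 1
      simp only [eq_iff_iff]
      omega
    · rw [if_neg h0, if_neg (by omega)]
      simp
  simp only [h]
  split_ifs with hN
  · rw [Finset.sum_eq_single (-N).toNat]
    · rw [if_pos (by omega)]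
    · intro s _ hs
      rw [if_neg (by omega)]
    · intro hs
      rw [hM _ (by simpa using hs), map_zero, ite_self]
  · exact Finset.sum_eq_zero fun s _ => if_neg (by omega)

/-! ### Formal exponentials in commutative algebras -/

section Commutative

variable {A : Type*} [CommRing A]

/-- `T` plays the role of the logarithmic derivative of `Q`; the product form Q' = TQ avoids
division. -/
theorem derivative_pow_eq {Q T : PowerSeries A} (hQ : PowerSeries.derivative A Q = T * Q) (n : ℕ) :
    PowerSeries.derivative A (Q ^ n) = ((n : PowerSeries A) * T) * Q ^ n := by
  cases n with
  | zero => simp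
  | succ n =>
    rw [Derivation.leibniz_pow, hQ]
    simp only [nsmul_eq_mul, smul_eq_mul, Nat.add_sub_cancel, pow_succ]
    ring

theorem derivative_prod_eq {ι : Type*} (s : Finset ι) {Q T : ι → PowerSeries A}
    (hQ : ∀ i ∈ s, PowerSeries.derivative A (Q i) = T i * Q i) :
    PowerSeries.derivative A (∏ i ∈ s, Q i) = (∑ i ∈ s, T i) * ∏ i ∈ s, Q i := by
  classical
  induction s using Finset.induction_on with
  | empty => simp
  | insert i s hi ih =>
    rw [Finset.prod_insert hi, Finset.sum_insert hi, Derivation.leibniz,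
      ih fun j hj => hQ j (Finset.mem_insert_of_mem hj), hQ i (Finset.mem_insert_self i s)]
    simp only [smul_eq_mul]
    ring

theorem derivative_one_sub_C_mul_X (x : A) :
    PowerSeries.derivative A (1 - PowerSeries.C x * PowerSeries.X)
      = (-PowerSeries.mk fun n => x ^ (n + 1)) * (1 - PowerSeries.C x * PowerSeries.X) := by
  ext n
  rw [PowerSeries.coeff_derivative, mul_sub, mul_one, ← mul_assoc, map_sub, map_sub]
  cases n with
  | zero => simp [PowerSeries.coeff_one]
  | succ n =>
    simp [PowerSeries.coeff_succ_mul_X, PowerSeries.coeff_one, pow_succ]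

variable [Algebra ℂ A]

/-- The linear equation f' = Tf gives (n+1) f_{n+1} in terms of earlier coefficients, and n+1 is
invertible in a ℂ-algebra. -/
theorem eq_of_derivative_eq_mul {f g T : PowerSeries A}
    (h0 : PowerSeries.coeff 0 f = PowerSeries.coeff 0 g)
    (hf : PowerSeries.derivative A f = T * f) (hg : PowerSeries.derivative A g = T * g) : f = g := by
  ext n
  induction n using Nat.strong_induction_on with
  | _ n ih =>
    cases n with
    | zero => exact h0
    | succ n =>
      have h1 := congrArg (PowerSeries.coeff n) hf
      have h2 := congrArg (PowerSeries.coeff n) hg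
      rw [PowerSeries.coeff_derivative, PowerSeries.coeff_mul] at h1 h2
      have h3 : PowerSeries.coeff (n + 1) f * ((n : A) + 1)
          = PowerSeries.coeff (n + 1) g * ((n : A) + 1) := by
        rw [h1, h2]
        refine Finset.sum_congr rfl fun p hp => ?_
        rw [HasAntidiagonal.mem_antidiagonal] at hp
        rw [ih p.2 (by omega)]
      have h4 : IsUnit ((n : A) + 1) := by
        have : IsUnit (algebraMap ℂ A ((n : ℂ) + 1)) :=
          (IsUnit.mk0 _ (by exact_mod_cast n.succ_ne_zero)).map _
        simpa using this
      exact h4.mul_right_cancel h3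

theorem derivative_mk_expCoeff {S : PowerSeries A} (h0 : PowerSeries.coeff 0 S = 0) :
    PowerSeries.derivative A (PowerSeries.mk (expCoeff S))
      = PowerSeries.derivative A S * PowerSeries.mk (expCoeff S) := by
  ext n
  have htr : ∀ M N : ℕ, N < M → expCoeff S N
      = PowerSeries.coeff N (∑ r ∈ range M, ((r.factorial : ℂ)⁻¹) • S ^ r) := by
    intro M N h
    rw [expCoeff_eq_sum_range h0 h, map_sum]
    rfl
  have h1 : PowerSeries.coeff n (PowerSeries.derivative A (PowerSeries.mk (expCoeff S)))
      = PowerSeries.coeff n (PowerSeries.derivative A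
        (∑ r ∈ range (n + 2), ((r.factorial : ℂ)⁻¹) • S ^ r)) := by
    rw [PowerSeries.coeff_derivative, PowerSeries.coeff_derivative, PowerSeries.coeff_mk,
      htr (n + 2) (n + 1) (by omega)]
  have h2 : PowerSeries.coeff n (PowerSeries.derivative A S * PowerSeries.mk (expCoeff S))
      = PowerSeries.coeff n (PowerSeries.derivative A S *
        (∑ r ∈ range (n + 1), ((r.factorial : ℂ)⁻¹) • S ^ r)) := by
    rw [PowerSeries.coeff_mul, PowerSeries.coeff_mul]
    refine Finset.sum_congr rfl fun p hp => ?_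
    rw [HasAntidiagonal.mem_antidiagonal] at hp
    rw [PowerSeries.coeff_mk, htr (n + 1) p.2 (by omega)]
  rw [h1, h2]
  congr 1
  rw [Finset.sum_range_succ', map_add, map_sum, Finset.mul_sum]
  have h3 : ∀ (c : ℂ) (f : PowerSeries A), PowerSeries.derivative A (c • f)
      = c • PowerSeries.derivative A f := by
    intro c f
    ext n
    simp [PowerSeries.coeff_derivative]
  simp only [pow_zero, h3, Derivation.map_one_eq_zero, smul_zero, add_zero]
  refine Finset.sum_congr rfl fun r _ => ?_
  rw [Derivation.leibniz_pow, mul_smul_comm, Nat.add_sub_cancel, ← Nat.cast_smul_eq_nsmul ℂ,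
    smul_smul, smul_eq_mul, mul_comm (S ^ r)]
  congr 1
  have : (r.factorial : ℂ) ≠ 0 := by exact_mod_cast r.factorial_ne_zero
  have : (r : ℂ) + 1 ≠ 0 := by exact_mod_cast r.succ_ne_zero
  rw [Nat.factorial_succ]
  push_cast
  field_simp

theorem expCoeff_eq_coeff {S Q : PowerSeries A} (h0 : PowerSeries.coeff 0 S = 0)
    (h1 : PowerSeries.coeff 0 Q = 1)
    (hQ : PowerSeries.derivative A Q = PowerSeries.derivative A S * Q) (N : ℕ) :
    expCoeff S N = PowerSeries.coeff N Q := by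
  rw [← eq_of_derivative_eq_mul _ (derivative_mk_expCoeff h0) hQ, PowerSeries.coeff_mk]
  rw [PowerSeries.coeff_mk, h1]
  simp [expCoeff]

/-- `exp (-M ∑_{i ≥ 1} p_i t ^ i / i) = ∏ (1 - x t) ^ M` for the power sums `p_i` of elements `x`. -/
theorem expCoeff_powerSum {ι : Type*} [Fintype ι] (x : ι → A) (M s : ℕ) :
    expCoeff (PowerSeries.mk fun i : ℕ => match i with
      | 0 => 0
      | k + 1 => (-((M : ℂ) / ((k : ℂ) + 1))) • ∑ i, x i ^ (k + 1)) s
    = (∏ i, (1 - Polynomial.C (x i) * Polynomial.X) ^ M : Polynomial A).coeff s := by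
  rw [← Polynomial.coeff_coe]
  refine expCoeff_eq_coeff (by simp) ?_ ?_ s
  · rw [Polynomial.coeff_coe, Polynomial.coeff_zero_eq_eval_zero, Polynomial.eval_prod]
    simp
  · have h1 : ((∏ i, (1 - Polynomial.C (x i) * Polynomial.X) ^ M : Polynomial A) : PowerSeries A)
        = ∏ i, (1 - PowerSeries.C (x i) * PowerSeries.X) ^ M := by
      rw [← Polynomial.coeToPowerSeries.ringHom_apply, map_prod]
      simp
    -- Both sides have logarithmic derivative -M ∑_n (∑_i x_i^(n+1)) t^n.
    rw [h1, derivative_prod_eq univ fun i _ =>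
      derivative_pow_eq (derivative_one_sub_C_mul_X (x i)) M]
    congr 1
    ext n
    rw [PowerSeries.coeff_derivative, PowerSeries.coeff_mk, map_sum]
    have h2 : ((n : ℂ) + 1) ≠ 0 := by exact_mod_cast n.succ_ne_zero
    have h3 : ((n : A) + 1) = algebraMap ℂ A ((n : ℂ) + 1) := by simp
    have h4 : ∀ i, PowerSeries.coeff n ((M : PowerSeries A) * -PowerSeries.mk fun n => x i ^ (n + 1))
        = -((M : A) * x i ^ (n + 1)) := by
      intro i
      have : (M : PowerSeries A) = PowerSeries.C (M : A) := by simp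
      rw [this, PowerSeries.coeff_C_mul]
      simp
    simp only [h4]
    rw [h3, mul_comm, ← Algebra.smul_def, smul_smul, Finset.sum_neg_distrib, ← Finset.mul_sum,
      mul_neg, mul_div_cancel₀ _ h2, neg_smul, Algebra.smul_def]
    simp

end Commutative

theorem reverse_X_sub_C {A : Type*} [CommRing A] [Nontrivial A] (x : A) :
    (Polynomial.X - Polynomial.C x).reverse = 1 - Polynomial.C x * Polynomial.X := by
  ext n
  rw [Polynomial.coeff_reverse, Polynomial.natDegree_X_sub_C]
  rcases n with _ | _ | n
  · rw [Polynomial.revAt_le (by omega)]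
    simp
  · rw [Polynomial.revAt_le (by omega)]
    simp [Polynomial.coeff_one]
  · rw [Polynomial.revAt_eq_self_of_lt (by omega)]
    simp [Polynomial.coeff_one, Polynomial.coeff_X]

theorem reverse_prod_X_sub_C {A : Type*} [CommRing A] [IsDomain A] {ι : Type*} (s : Finset ι)
    (x : ι → A) (M : ℕ) :
    (∏ i ∈ s, (Polynomial.X - Polynomial.C (x i)) ^ M).reverse
      = ∏ i ∈ s, (1 - Polynomial.C (x i) * Polynomial.X) ^ M := by
  have hpow : ∀ (f : Polynomial A) (n : ℕ), (f ^ n).reverse = f.reverse ^ n := by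
    intro f n
    induction n with
    | zero => simpa using Polynomial.reverse_C (1 : A)
    | succ n ih => rw [pow_succ, pow_succ, Polynomial.reverse_mul_of_domain, ih]
  classical
  induction s using Finset.induction_on with
  | empty => simpa using Polynomial.reverse_C (1 : A)
  | insert i s hi ih =>
    rw [Finset.prod_insert hi, Finset.prod_insert hi, Polynomial.reverse_mul_of_domain, ih, hpow,
      reverse_X_sub_C]

theorem natDegree_prod_X_sub_C_pow {A : Type*} [CommRing A] [IsDomain A] {ι : Type*} (s : Finset ι)
    (x : ι → A) (M : ℕ) :
    (∏ i ∈ s, (Polynomial.X - Polynomial.C (x i)) ^ M).natDegree = M * #s := by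
  rw [Polynomial.natDegree_prod_of_monic _ _ fun i _ => (Polynomial.monic_X_sub_C _).pow M]
  simp [mul_comm]

/-- The coefficients of `∏ (1 - x t) ^ M` are those of `∏ (t - x) ^ M`, in reverse order. -/
theorem coeff_prod_one_sub {A : Type*} [CommRing A] [IsDomain A] {ι : Type*} (s : Finset ι)
    (x : ι → A) (M N : ℕ) :
    (∏ i ∈ s, (1 - Polynomial.C (x i) * Polynomial.X) ^ M).coeff N
      = if N ≤ M * #s then
        (∏ i ∈ s, (Polynomial.X - Polynomial.C (x i)) ^ M).coeff (M * #s - N) else 0 := by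
  rw [← reverse_prod_X_sub_C, Polynomial.coeff_reverse, natDegree_prod_X_sub_C_pow]
  split_ifs with h
  · rw [Polynomial.revAt_le h]
  · rw [Polynomial.revAt_eq_self_of_lt (by omega)]
    refine Polynomial.coeff_eq_zero_of_natDegree_lt ?_
    rw [natDegree_prod_X_sub_C_pow]
    omega

/-! ### Words in the vertex operators -/

/-- The Fock space component of `a_{-m-r_0} a_{-m-r_1} ⋯ a_{-m-r_{k-1}} v_{1-m}`. -/
def fockWord (m : ℕ) : (k : ℕ) → (Fin k →₀ ℕ) → Fock
  | 0, _ => 1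
  | k + 1, r => vertexCoeff m ((r 0 : ℤ) - 2 * m * k) (fockWord m k r.tail)

/-- The generating series of the values of a functional on the vectors `fockWord m k r`. -/
def transpose (m k : ℕ) : (Fock →ₗ[ℂ] ℂ) →ₗ[ℂ] MvPowerSeries (Fin k) ℂ where
  toFun ξ := fun r => ξ (fockWord m k r)
  map_add' _ _ := rfl
  map_smul' _ _ := rfl

theorem coeff_transpose (m k : ℕ) (ξ : Fock →ₗ[ℂ] ℂ) (r : Fin k →₀ ℕ) :
    MvPowerSeries.coeff r (transpose m k ξ) = ξ (fockWord m k r) := rfl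

/-- Annihilation operators act on words by shifts of the exponents. -/
def HasShift (m k : ℕ) : Prop := ∀ (j : ℕ) (r : Fin k →₀ ℕ), annih j (fockWord m k r)
  = sqrtTwo m • ∑ i, if Finsupp.single i (j + 1) ≤ r
      then fockWord m k (r - Finsupp.single i (j + 1)) else 0

theorem coeff_psum_mul {k : ℕ} (n : ℕ) (φ : MvPowerSeries (Fin k) ℂ) (r : Fin k →₀ ℕ) :
    MvPowerSeries.coeff r ((psum (Fin k) ℂ n : MvPowerSeries (Fin k) ℂ) * φ)
      = ∑ i, if Finsupp.single i n ≤ r then MvPowerSeries.coeff (r - Finsupp.single i n) φ else 0 := by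
  have h : (psum (Fin k) ℂ n : MvPowerSeries (Fin k) ℂ)
      = ∑ i, MvPowerSeries.monomial (Finsupp.single i n) 1 := by
    rw [psum, ← coeToMvPowerSeries.ringHom_apply, map_sum]
    simp [MvPowerSeries.X_pow_eq]
  rw [h, Finset.sum_mul, map_sum]
  simp [MvPowerSeries.coeff_monomial_mul]

/-- Lowering one exponent of a word is, on generating series, multiplication by a power of the
corresponding variable; summing over the positions gives a power sum. -/
theorem transpose_annih {m k : ℕ} (h : HasShift m k) (ξ : Fock →ₗ[ℂ] ℂ) (j : ℕ) :
    transpose m k (ξ ∘ₗ annih j)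
      = sqrtTwo m • ((psum (Fin k) ℂ (j + 1) : MvPowerSeries (Fin k) ℂ) * transpose m k ξ) := by
  ext r
  rw [MvPowerSeries.coeff_smul, coeff_psum_mul, coeff_transpose, LinearMap.comp_apply, h j r,
    map_smul, map_sum]
  congr 1
  refine Finset.sum_congr rfl fun i _ => ?_
  rw [coeff_transpose]
  split_ifs <;> simp

/-- Transposition reverses the order of composition, which is harmless because the transposed
operators are multiplications in a commutative ring. -/
theorem transpose_comp_coeff_pow {m k : ℕ} {S : PowerSeries (Module.End ℂ Fock)}
    {T : PowerSeries (MvPolynomial (Fin k) ℂ)}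
    (h : ∀ i ξ, transpose m k (ξ ∘ₗ PowerSeries.coeff i S)
      = ((PowerSeries.coeff i T : MvPolynomial (Fin k) ℂ) : MvPowerSeries (Fin k) ℂ) * transpose m k ξ) (r : ℕ) :
    ∀ (s : ℕ) (ξ : Fock →ₗ[ℂ] ℂ), transpose m k (ξ ∘ₗ PowerSeries.coeff s (S ^ r))
      = ((PowerSeries.coeff s (T ^ r) : MvPolynomial (Fin k) ℂ) : MvPowerSeries (Fin k) ℂ) * transpose m k ξ := by
  induction r with
  | zero =>
    intro s ξ
    rw [pow_zero, pow_zero, PowerSeries.coeff_one, PowerSeries.coeff_one]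
    split_ifs
    · rw [MvPolynomial.coe_one, one_mul]; rfl
    · rw [MvPolynomial.coe_zero, zero_mul, LinearMap.comp_zero, map_zero]
  | succ r ih =>
    intro s ξ
    have h1 : ξ ∘ₗ PowerSeries.coeff s (S ^ (r + 1)) = ∑ p ∈ antidiagonal s,
        (ξ ∘ₗ PowerSeries.coeff p.1 (S ^ r)) ∘ₗ PowerSeries.coeff p.2 S := by
      rw [pow_succ, PowerSeries.coeff_mul]
      ext f
      simp
    rw [h1, map_sum, pow_succ, PowerSeries.coeff_mul, ← coeToMvPowerSeries.ringHom_apply, map_sum,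
      Finset.sum_mul]
    refine Finset.sum_congr rfl fun p _ => ?_
    rw [h, ih, coeToMvPowerSeries.ringHom_apply, MvPolynomial.coe_mul]
    ring

theorem transpose_comp_expCoeff {m k : ℕ} {S : PowerSeries (Module.End ℂ Fock)}
    {T : PowerSeries (MvPolynomial (Fin k) ℂ)}
    (h : ∀ i ξ, transpose m k (ξ ∘ₗ PowerSeries.coeff i S)
      = ((PowerSeries.coeff i T : MvPolynomial (Fin k) ℂ) : MvPowerSeries (Fin k) ℂ) * transpose m k ξ) (s : ℕ)
    (ξ : Fock →ₗ[ℂ] ℂ) : transpose m k (ξ ∘ₗ expCoeff S s)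
      = ((expCoeff T s : MvPolynomial (Fin k) ℂ) : MvPowerSeries (Fin k) ℂ) * transpose m k ξ := by
  have h1 : ξ ∘ₗ expCoeff S s = ∑ r ∈ range (s + 1), ((r.factorial : ℂ)⁻¹) •
      (ξ ∘ₗ PowerSeries.coeff s (S ^ r)) := by
    rw [expCoeff]
    ext f
    simp
  rw [h1, map_sum, expCoeff, ← coeToMvPowerSeries.ringHom_apply, map_sum, Finset.sum_mul]
  refine Finset.sum_congr rfl fun r _ => ?_
  rw [map_smul, transpose_comp_coeff_pow h, smul_eq_C_mul, map_mul,
    coeToMvPowerSeries.ringHom_apply, coeToMvPowerSeries.ringHom_apply, coe_C, mul_assoc,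
    MvPowerSeries.smul_eq_C_mul]

/-- The polynomial `∏ (1 - X_i t) ^ (2m)` in `t`. -/
def shiftPoly (m k : ℕ) : Polynomial (MvPolynomial (Fin k) ℂ) :=
  ∏ i, (1 - Polynomial.C (X i) * Polynomial.X) ^ (2 * m)

/-- Since √(2m)² = 2m, the exponent transposes to -2m ∑ p_i t^i / i, whose exponential is ∏ (1 - X_i
t)^(2m). -/
theorem transpose_expAnnih {m k : ℕ} (h : HasShift m k) (s : ℕ) (ξ : Fock →ₗ[ℂ] ℂ) :
    transpose m k (ξ ∘ₗ expAnnih m s)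
      = ((shiftPoly m k).coeff s : MvPowerSeries (Fin k) ℂ) * transpose m k ξ := by
  rw [shiftPoly, ← expCoeff_powerSum, expAnnih]
  refine transpose_comp_expCoeff (fun i ξ => ?_) s ξ
  cases i with
  | zero => simp
  | succ j =>
    rw [PowerSeries.coeff_mk, PowerSeries.coeff_mk]
    simp only
    rw [LinearMap.comp_smul, map_smul, transpose_annih h, smul_smul, smul_eq_C_mul, MvPolynomial.coe_mul, coe_C,
      mul_assoc, ← MvPowerSeries.smul_eq_C_mul]
    congr 1
    rw [neg_mul, div_mul_eq_mul_div, sqrtTwo_mul_self]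
    push_cast
    rfl

/-- The polynomial ∏ (1 - X_i t)^(2m) has degree at most 2mk in t. -/
theorem expAnnih_fockWord_eq_zero {m k : ℕ} (h : HasShift m k) {s : ℕ} (hs : 2 * m * k < s)
    (r : Fin k →₀ ℕ) : expAnnih m s (fockWord m k r) = 0 := by
  ext μ
  have h1 := congrArg (MvPowerSeries.coeff r) (transpose_expAnnih h s (lcoeff ℂ μ))
  rw [shiftPoly, coeff_prod_one_sub, if_neg (by simpa using hs), MvPolynomial.coe_zero, zero_mul] at h1
  exact h1

theorem vertexCoeff_fockWord_eq_zero {m k : ℕ} (h : HasShift m k) {N : ℤ}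
    (hN : N < -(2 * m * k : ℕ)) (r : Fin k →₀ ℕ) : vertexCoeff m N (fockWord m k r) = 0 := by
  rw [vertexCoeff_apply m N _ (M := 2 * m * k + 1)
    fun s hs => expAnnih_fockWord_eq_zero h (by omega) r]
  refine Finset.sum_eq_zero fun s hs => ?_
  rw [Finset.mem_range] at hs
  rw [expCreateInt, if_neg (by omega), LinearMap.zero_apply]

/-- Commuting h_{j+1} past the outermost vertex operator lowers r_0; the induction hypothesis lowers
the other exponents. -/
theorem hasShift (m k : ℕ) : HasShift m k := by
  induction k with
  | zero => intro j r; simp [fockWord, annih]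
  | succ k ih =>
    intro j r
    rw [fockWord, annih_vertexCoeff, ih j r.tail, map_smul, map_sum, ← smul_add, Fin.sum_univ_succ,
      add_comm]
    congr 2
    · by_cases h : Finsupp.single 0 (j + 1) ≤ r
      · have h0 : j + 1 ≤ r 0 := by simpa using h 0
        rw [if_pos h, fockWord]
        congr 2
        · simp only [Finsupp.coe_tsub, Pi.sub_apply, Finsupp.single_eq_same]
          push_cast [h0]
          ring
        · ext i
          simp [Finsupp.tail_apply]
      -- Here the lowered exponent would be negative: the index of the vertex coefficient falls
      -- below -2mk, where it kills every word of length k.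
      · have h0 : ¬ j + 1 ≤ r 0 := by
          intro h0
          refine h (Finsupp.single_le_iff.mpr h0)
        rw [if_neg h]
        refine vertexCoeff_fockWord_eq_zero ih ?_ _
        push_cast
        omega
    · refine Finset.sum_congr rfl fun i _ => ?_
      simp only [Finsupp.single_le_iff, Finsupp.tail_apply]
      split_ifs with h
      · rw [fockWord]
        congr 2
        · simp
        · ext i'
          simp [Finsupp.tail_apply, Finsupp.single_apply]
      · simp

/-! ### Correlation functions -/

/-- The polynomial `∏_{i < j} (X_i - X_j) ^ (2m)`. -/
def discr (m : ℕ) : (k : ℕ) → MvPolynomial (Fin k) ℂ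
  | 0 => 1
  | k + 1 => (∏ i : Fin k, (X 0 - X i.succ) ^ (2 * m)) * rename Fin.succ (discr m k)

theorem finSuccEquiv_rename_succ {k : ℕ} (p : MvPolynomial (Fin k) ℂ) :
    finSuccEquiv ℂ k (rename Fin.succ p) = Polynomial.C p := by
  induction p using MvPolynomial.induction_on with
  | C c => simp [finSuccEquiv_apply]
  | add p q hp hq => rw [map_add, map_add, hp, hq, map_add]
  | mul_X p i hp => rw [map_mul, map_mul, hp, rename_X, finSuccEquiv_X_succ, map_mul]

theorem finSuccEquiv_discr (m k : ℕ) : finSuccEquiv ℂ k (discr m (k + 1))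
    = (∏ i, (Polynomial.X - Polynomial.C (X i)) ^ (2 * m)) * Polynomial.C (discr m k) := by
  rw [discr, map_mul, finSuccEquiv_rename_succ, map_prod]
  simp [finSuccEquiv_X_succ, finSuccEquiv_X_zero]

theorem constantCoeff_fockWord (m k : ℕ) (r : Fin k →₀ ℕ) :
    constantCoeff (fockWord m k r) = coeff r (discr m k) := by
  induction k with
  | zero =>
    rw [fockWord, discr, Subsingleton.elim r 0]
    simp
  | succ k ih =>
    have ht : transpose m k (lcoeff ℂ 0) = (discr m k : MvPowerSeries (Fin k) ℂ) := by
      ext r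
      rw [coeff_transpose, coeff_coe, ← ih r]
      rfl
    have hr : coeff r (discr m (k + 1)) = coeff r.tail
        ((∏ i : Fin k, (Polynomial.X - Polynomial.C (X i)) ^ (2 * m) :
          Polynomial (MvPolynomial (Fin k) ℂ)).coeff (r 0) * discr m k) := by
      conv_lhs => rw [← Finsupp.cons_tail r]
      rw [← finSuccEquiv_coeff_coeff, finSuccEquiv_discr, Polynomial.coeff_mul_C]
    rw [hr, fockWord, constantCoeff_vertexCoeff]
    split_ifs with h
    -- The outermost operator contributes its annihilation part of index 2mk - r_0. Reversal turns
    -- that coefficient of ∏ (1 - X_i t)^(2m) into the coefficient of t^(r_0) in ∏ (t - X_i)^(2m),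
    -- the factor by which Δ grows with one more variable.
    · have h1 := congrArg (MvPowerSeries.coeff r.tail)
        (transpose_expAnnih (hasShift m k) (-((r 0 : ℤ) - 2 * m * k)).toNat (lcoeff ℂ 0))
      rw [ht, ← MvPolynomial.coe_mul, coeff_coe, shiftPoly, coeff_prod_one_sub, Finset.card_univ,
        Fintype.card_fin] at h1
      have h2 : ((r 0 : ℤ) - (2 * m * k : ℕ)) ≤ 0 := by push_cast; exact h
      have h3 : (-((r 0 : ℤ) - 2 * m * k)).toNat = 2 * m * k - r 0 := by
        have : (2 * m * k : ℤ) = (2 * m * k : ℕ) := by push_cast; rfl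
        rw [this]
        omega
      rw [h3, if_pos (by omega), Nat.sub_sub_self (by omega)] at h1
      rw [← h1, h3]
      rfl
    · rw [Polynomial.coeff_eq_zero_of_natDegree_lt, zero_mul, coeff_zero]
      rw [natDegree_prod_X_sub_C_pow, Finset.card_univ, Fintype.card_fin]
      have h2 : ¬ ((r 0 : ℤ) - (2 * m * k : ℕ)) ≤ 0 := by push_cast; exact h
      omega

theorem coeff_annih (j : ℕ) (μ : ℕ →₀ ℕ) (f : Fock) : coeff μ (annih j f)
    = ((j : ℂ) + 1) * ((μ j : ℂ) + 1) * coeff (μ + Finsupp.single j 1) f := by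
  induction f using MvPolynomial.induction_on' with
  | monomial e c =>
    rw [annih, LinearMap.smul_apply, Derivation.coeFn_coe, pderiv_monomial, coeff_smul,
      coeff_monomial, coeff_monomial, smul_eq_mul]
    by_cases h : e j = 0
    · have : e ≠ μ + Finsupp.single j 1 := by
        rintro rfl
        simp at h
      simp [h, this]
    · have h1 : e - Finsupp.single j 1 = μ ↔ e = μ + Finsupp.single j 1 := by
        constructor
        · rintro rfl
          exact (Finsupp.sub_add_single_one_cancel h).symm
        · rintro rfl
          simp
      simp only [h1]
      split_ifs with h2
      · subst h2
        simp
        ring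
      · simp
  | add p q hp hq => rw [map_add, coeff_add, hp, hq, coeff_add]; ring

/-- The product of power sums `∏ p_{j+1} ^ {μ j}`. -/
def psumProd (k : ℕ) (μ : ℕ →₀ ℕ) : MvPolynomial (Fin k) ℂ :=
  μ.prod fun j e => psum (Fin k) ℂ (j + 1) ^ e

theorem psumProd_add_single (k : ℕ) (μ : ℕ →₀ ℕ) (j : ℕ) :
    psumProd k (μ + Finsupp.single j 1) = psum (Fin k) ℂ (j + 1) * psumProd k μ := by
  rw [psumProd, Finsupp.prod_add_index' (by simp) (by simp [pow_add]), mul_comm, psumProd]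
  simp

theorem sqrtTwo_ne_zero {m : ℕ} (hm : 1 ≤ m) : sqrtTwo m ≠ 0 := by
  intro h
  have hs := sqrtTwo_mul_self m
  rw [h] at hs
  have : (m : ℂ) ≠ 0 := by exact_mod_cast (by omega : m ≠ 0)
  simp_all

/-- The coefficients of the words are, up to nonzero factors, those of power sum multiples of
`∏_{i < j} (X_i - X_j) ^ (2m)`. -/
theorem exists_coeff_fockWord {m : ℕ} (hm : 1 ≤ m) (k : ℕ) (μ : ℕ →₀ ℕ) :
    ∃ c : ℂ, c ≠ 0 ∧ ∀ r, coeff μ (fockWord m k r) = c * coeff r (psumProd k μ * discr m k) := by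
  induction h : μ.degree generalizing μ with
  | zero =>
    rw [Finsupp.degree_eq_zero_iff] at h
    subst h
    refine ⟨1, one_ne_zero, fun r => ?_⟩
    have := constantCoeff_fockWord m k r
    simp [psumProd, ← this, constantCoeff_eq]
  | succ d ih =>
    obtain ⟨j, hj⟩ : ∃ j, μ j ≠ 0 := by
      by_contra! h0
      have : μ = 0 := Finsupp.ext h0
      simp [this] at h
    obtain ⟨ν, rfl⟩ : ∃ ν, μ = ν + Finsupp.single j 1 :=
      ⟨_, (Finsupp.sub_add_single_one_cancel hj).symm⟩
    obtain ⟨c, hc, hcr⟩ := ih ν (by simpa using h)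
    have h1 : ((j : ℂ) + 1) ≠ 0 := by exact_mod_cast j.succ_ne_zero
    have h2 : ((ν j : ℂ) + 1) ≠ 0 := by exact_mod_cast (ν j).succ_ne_zero
    -- The denominator is the factor produced by `coeff_annih` in passing from ν to ν + e_j; the
    -- numerator √(2m) comes from `transpose_annih`.
    refine ⟨sqrtTwo m * c / (((j : ℂ) + 1) * ((ν j : ℂ) + 1)), by
      have := sqrtTwo_ne_zero hm
      positivity, fun r => ?_⟩
    have h3 := coeff_annih j ν (fockWord m k r)
    have h4 : transpose m k (lcoeff ℂ ν) = MvPowerSeries.C c *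
        ((psumProd k ν * discr m k : MvPolynomial (Fin k) ℂ) : MvPowerSeries (Fin k) ℂ) := by
      ext r
      rw [coeff_transpose, MvPowerSeries.coeff_C_mul, coeff_coe, ← hcr r]
      rfl
    have h5 := congrArg (MvPowerSeries.coeff r) (transpose_annih (hasShift m k) (lcoeff ℂ ν) j)
    rw [h4, mul_left_comm, ← MvPolynomial.coe_mul, MvPowerSeries.coeff_smul, MvPowerSeries.coeff_C_mul,
      coeff_coe, ← mul_assoc (psum _ _ _), ← psumProd_add_single, coeff_transpose, LinearMap.comp_apply,
      lcoeff_apply, h3] at h5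
    field_simp
    linear_combination h5

/-! ### Power sums generate the symmetric polynomials -/

theorem psumProd_mem_symmetric (k : ℕ) (μ : ℕ →₀ ℕ) : (psumProd k μ).IsSymmetric := by
  rw [← mem_symmetricSubalgebra]
  exact Subalgebra.prod_mem _ fun j _ => Subalgebra.pow_mem _ (psum_isSymmetric _ _ _) _

/-- Newton's identities express n e_n through power sums and lower e_i, and n is invertible in ℂ. -/
theorem esymm_mem_range_aeval_psum (k n : ℕ) : esymm (Fin k) ℂ n
    ∈ (aeval fun j : ℕ => psum (Fin k) ℂ (j + 1) : MvPolynomial ℕ ℂ →ₐ[ℂ] _).range := by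
  set R := (aeval fun j : ℕ => psum (Fin k) ℂ (j + 1) : MvPolynomial ℕ ℂ →ₐ[ℂ] _).range
  induction n using Nat.strong_induction_on with
  | _ n ih =>
    rcases Nat.eq_zero_or_pos n with rfl | hn
    · rw [esymm_zero]
      exact R.one_mem
    · have h := mul_esymm_eq_sum (Fin k) ℂ n
      have h1 : (n : MvPolynomial (Fin k) ℂ) * esymm (Fin k) ℂ n ∈ R := by
        rw [h]
        refine R.mul_mem (R.pow_mem (R.neg_mem R.one_mem) _) (R.sum_mem fun a ha => ?_)
        rw [Finset.mem_filter, HasAntidiagonal.mem_antidiagonal] at ha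
        refine R.mul_mem (R.mul_mem (R.pow_mem (R.neg_mem R.one_mem) _) (ih _ ha.2)) ?_
        obtain ⟨j, hj⟩ : ∃ j, a.2 = j + 1 := ⟨a.2 - 1, by omega⟩
        exact ⟨X j, by simp [hj]⟩
      have h2 : esymm (Fin k) ℂ n = (n : ℂ)⁻¹ • ((n : MvPolynomial (Fin k) ℂ) * esymm (Fin k) ℂ n) := by
        have : (n : ℂ) ≠ 0 := by exact_mod_cast hn.ne'
        rw [← nsmul_eq_mul, ← Nat.cast_smul_eq_nsmul ℂ, smul_smul, inv_mul_cancel₀ this, one_smul]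
      rw [h2]
      exact R.smul_mem h1 _

theorem mem_span_psumProd {k : ℕ} {g : MvPolynomial (Fin k) ℂ} (hg : g.IsSymmetric) :
    g ∈ Submodule.span ℂ (Set.range (psumProd k)) := by
  have h1 : g ∈ (aeval fun j : ℕ => psum (Fin k) ℂ (j + 1) : MvPolynomial ℕ ℂ →ₐ[ℂ] _).range := by
    obtain ⟨p, hp⟩ := esymmAlgHom_surjective (σ := Fin k) (R := ℂ) (n := k) (by simp) ⟨g, hg⟩
    have hp' := congrArg Subtype.val hp
    rw [esymmAlgHom_apply] at hp'
    simp only at hp'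
    rw [← hp']
    have h2 : (aeval (fun i : Fin k => esymm (Fin k) ℂ (i + 1)) : MvPolynomial (Fin k) ℂ →ₐ[ℂ] _).range
        ≤ (aeval fun j : ℕ => psum (Fin k) ℂ (j + 1) : MvPolynomial ℕ ℂ →ₐ[ℂ] _).range := by
      rw [← Algebra.adjoin_range_eq_range_aeval, Algebra.adjoin_le_iff]
      rintro _ ⟨i, rfl⟩
      exact esymm_mem_range_aeval_psum k _
    exact h2 ⟨p, rfl⟩
  obtain ⟨p, rfl⟩ := h1
  simp only [AlgHom.toRingHom_eq_coe, RingHom.coe_coe]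
  clear hg
  induction p using MvPolynomial.induction_on' with
  | monomial e c =>
    rw [aeval_monomial, ← Algebra.smul_def]
    exact Submodule.smul_mem _ _ (Submodule.subset_span ⟨e, rfl⟩)
  | add p q hp hq =>
    rw [map_add]
    exact Submodule.add_mem _ hp hq

/-! ### Homogeneity -/

theorem discr_isHomogeneous (m k : ℕ) : (discr m k).IsHomogeneous (m * (k * (k - 1))) := by
  induction k with
  | zero => exact isHomogeneous_one _ _
  | succ k ih =>
    rw [discr]
    have h1 : (∏ i : Fin k, (X 0 - X i.succ : MvPolynomial (Fin (k + 1)) ℂ) ^ (2 * m)).IsHomogeneous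
        (∑ _i : Fin k, 1 * (2 * m)) := IsHomogeneous.prod _ _ _ fun i _ =>
          ((isHomogeneous_X _ _).sub (isHomogeneous_X _ _)).pow _
    have h2 := h1.mul (ih.rename_isHomogeneous (f := Fin.succ))
    convert h2 using 1
    rw [Finset.sum_const, Finset.card_univ, Fintype.card_fin, smul_eq_mul, Nat.add_sub_cancel]
    cases k with
    | zero => simp
    | succ k => simp; ring

theorem discr_ne_zero (m k : ℕ) : discr m k ≠ 0 := by
  induction k with
  | zero => exact one_ne_zero
  | succ k ih =>
    rw [discr]
    refine mul_ne_zero (Finset.prod_ne_zero_iff.mpr fun i _ => pow_ne_zero _ ?_) ?_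
    · rw [sub_ne_zero]
      intro h
      exact (Fin.succ_ne_zero i) (X_injective h).symm
    · rwa [Ne, map_eq_zero_iff _ (rename_injective _ (Fin.succ_injective k))]

theorem degreeOf_zero_discr (m k : ℕ) : degreeOf 0 (discr m (k + 1)) = 2 * m * k := by
  rw [← natDegree_finSuccEquiv, finSuccEquiv_discr, Polynomial.natDegree_mul_C (discr_ne_zero m k),
    natDegree_prod_X_sub_C_pow, Finset.card_univ, Fintype.card_fin]

theorem psum_isHomogeneous (k n : ℕ) : (psum (Fin k) ℂ n).IsHomogeneous n :=
  IsHomogeneous.sum _ _ _ fun i _ => by simpa using (isHomogeneous_X ℂ i).pow n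

/-- The weight of a Fock space monomial, `h_{-i}` having weight `i`. -/
abbrev wt : (ℕ →₀ ℕ) →+ ℕ := Finsupp.weight fun k : ℕ => k + 1

theorem psumProd_isHomogeneous (k : ℕ) (μ : ℕ →₀ ℕ) : (psumProd k μ).IsHomogeneous (wt μ) := by
  have h := IsHomogeneous.prod μ.support (fun j => psum (Fin k) ℂ (j + 1) ^ μ j)
    (fun j => (j + 1) * μ j) fun j _ => (psum_isHomogeneous k (j + 1)).pow _
  have hw : wt μ = ∑ j ∈ μ.support, (j + 1) * μ j := by
    rw [Finsupp.weight_apply, Finsupp.sum]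
    exact Finset.sum_congr rfl fun j _ => by rw [smul_eq_mul, mul_comm]
  rw [hw]
  exact h

theorem degree_of_coeff_fockWord_ne_zero {m : ℕ} (hm : 1 ≤ m) {k : ℕ} {r : Fin k →₀ ℕ}
    {μ : ℕ →₀ ℕ} (h : coeff μ (fockWord m k r) ≠ 0) :
    r.degree = wt μ + m * (k * (k - 1)) := by
  obtain ⟨c, hc, hcr⟩ := exists_coeff_fockWord hm k μ
  rw [hcr] at h
  rw [Finsupp.degree_eq_weight_one]
  exact (psumProd_isHomogeneous k μ).mul (discr_isHomogeneous m k) (right_ne_zero_of_mul h)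

/-- A Fock vector vanishes when all its coefficients do. On words these are nonzero multiples of the
coefficients of power sum products times Δ, and the products span the symmetric polynomials. -/
theorem sum_smul_fockWord_eq_zero_iff {m : ℕ} (hm : 1 ≤ m) {k : ℕ} {ι : Type*} [Fintype ι]
    (c : ι → ℂ) (r : ι → Fin k →₀ ℕ) : ∑ i, c i • fockWord m k (r i) = 0 ↔
      ∀ g : MvPolynomial (Fin k) ℂ, g.IsSymmetric → ∑ i, c i * coeff (r i) (g * discr m k) = 0 := by
  have h1 : ∀ μ, ∃ a : ℂ, a ≠ 0 ∧ coeff μ (∑ i, c i • fockWord m k (r i))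
      = a * ∑ i, c i * coeff (r i) (psumProd k μ * discr m k) := by
    intro μ
    obtain ⟨a, ha, har⟩ := exists_coeff_fockWord hm k μ
    refine ⟨a, ha, ?_⟩
    rw [coeff_sum, Finset.mul_sum]
    refine Finset.sum_congr rfl fun i _ => ?_
    rw [coeff_smul, har, smul_eq_mul]
    ring
  constructor
  · intro h g hg
    have h2 := mem_span_psumProd hg
    clear hg
    induction h2 using Submodule.span_induction with
    | mem g hg =>
      obtain ⟨μ, rfl⟩ := hg
      obtain ⟨a, ha, har⟩ := h1 μ
      rw [h, coeff_zero] at har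
      exact (mul_eq_zero.mp har.symm).resolve_left ha
    | zero => simp
    | add x y _ _ hx hy => simp [add_mul, mul_add, Finset.sum_add_distrib, hx, hy]
    | smul a x _ hx =>
      simp only [smul_mul_assoc, coeff_smul, smul_eq_mul, mul_left_comm, ← Finset.mul_sum, hx,
        mul_zero]
  · intro h
    ext μ
    obtain ⟨a, ha, har⟩ := h1 μ
    rw [har, h _ (psumProd_mem_symmetric k μ), mul_zero, coeff_zero]

/-! ### A duality for quotients of spans -/

/-- The vectors of `S → ℂ` vanishing on a set. -/
def vanishing {S : Type*} (B : Set S) : Submodule ℂ (S → ℂ) where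
  carrier := {w | ∀ s ∈ B, w s = 0}
  add_mem' hx hy s hs := by simp [hx s hs, hy s hs]
  zero_mem' _ _ := rfl
  smul_mem' c x hx s hs := by simp [hx s hs]

/-- The relations among the `u s` form the orthogonal of `W`, and `ker Ψ` is their sum with the
vectors supported on `B`. Its orthogonal is therefore `W ⊓ vanishing B`, whose dimension is the rank
of `Ψ`. -/
theorem finrank_range_eq_of_relations {S E E' : Type*} [Fintype S] [AddCommGroup E] [Module ℂ E]
    [AddCommGroup E'] [Module ℂ E'] (u : S → E) (W : Submodule ℂ (S → ℂ)) (B : Set S)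
    (hu : ∀ c : S → ℂ, ∑ s, c s • u s = 0 ↔ ∀ w ∈ W, ∑ s, c s * w s = 0)
    (Ψ : (S → ℂ) →ₗ[ℂ] E')
    (hΨ : ∀ c : S → ℂ, Ψ c = 0 ↔ ∑ s, c s • u s ∈ Submodule.span ℂ (u '' B)) :
    Module.finrank ℂ (LinearMap.range Ψ) = Module.finrank ℂ ↥(W ⊓ vanishing B) := by
  classical
  let β : LinearMap.BilinForm ℂ (S → ℂ) := dotProductBilin ℂ ℂ
  have hβ : ∀ x y, β x y = ∑ s, x s * y s := fun x y => rfl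
  have hsymm : β.IsSymm := ⟨fun x y => by simp [hβ, mul_comm]⟩
  have hrefl : β.IsRefl := hsymm.isRefl
  have hnd : β.Nondegenerate := by
    refine (LinearMap.IsRefl.nondegenerate_iff_separatingLeft hrefl).mpr fun x hx => ?_
    ext s
    simpa [hβ, Pi.single_apply] using hx (Pi.single s 1)
  have hperp : β.orthogonal (LinearMap.ker Ψ) = W ⊓ vanishing B := by
    ext x
    rw [LinearMap.BilinForm.mem_orthogonal_iff, Submodule.mem_inf]
    constructor
    · intro hx
      constructor
      · rw [← LinearMap.BilinForm.orthogonal_orthogonal hnd hrefl W,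
          LinearMap.BilinForm.mem_orthogonal_iff]
        intro c hc
        refine hx c ?_
        rw [LinearMap.mem_ker, hΨ, (hu c).mpr]
        · exact Submodule.zero_mem _
        · intro w hw
          rw [LinearMap.BilinForm.mem_orthogonal_iff] at hc
          have := hc w hw
          rw [hβ] at this
          simpa [mul_comm] using this
      · intro s hs
        have := hx (Pi.single s 1) (by
          rw [LinearMap.mem_ker, hΨ]
          simpa [Pi.single_apply, ite_smul] using Submodule.subset_span (Set.mem_image_of_mem u hs))
        simpa [hβ, Pi.single_apply] using this
    · rintro ⟨hxW, hxB⟩ c hc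
      rw [LinearMap.mem_ker, hΨ] at hc
      obtain ⟨d, hdB, hd⟩ : ∃ d : S → ℂ, (∀ s ∉ B, d s = 0) ∧ ∑ s, d s • u s = ∑ s, c s • u s := by
        generalize ∑ s, c s • u s = y at hc
        induction hc using Submodule.span_induction with
        | mem y hy =>
          obtain ⟨s, hs, rfl⟩ := hy
          refine ⟨Pi.single s 1, fun t ht => ?_, by simp [Pi.single_apply, ite_smul]⟩
          exact Pi.single_eq_of_ne (fun h : t = s => ht (h ▸ hs)) _
        | zero => exact ⟨0, by simp, by simp⟩
        | add y z _ _ hy hz =>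
          obtain ⟨d, hd, hd'⟩ := hy
          obtain ⟨e, he, he'⟩ := hz
          exact ⟨d + e, fun s hs => by simp [hd s hs, he s hs],
            by simp [add_smul, Finset.sum_add_distrib, hd', he']⟩
        | smul a y _ hy =>
          obtain ⟨d, hd, hd'⟩ := hy
          exact ⟨a • d, fun s hs => by simp [hd s hs], by simp [mul_smul, ← Finset.smul_sum, hd']⟩
      -- `c` splits as the relation `c - d`, orthogonal to `W`, plus `d`, supported on `B` where `x`
      -- vanishes.
      have h1 := (hu (c - d)).mp (by simp [sub_smul, Finset.sum_sub_distrib, hd]) x hxW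
      have h2 : ∑ s, d s * x s = 0 := Finset.sum_eq_zero fun s _ => by
        by_cases hs : s ∈ B
        · rw [hxB s hs, mul_zero]
        · rw [hdB s hs, zero_mul]
      rw [hβ]
      simpa [sub_mul, Finset.sum_sub_distrib, h2] using h1
  have h1 := LinearMap.finrank_range_add_finrank_ker Ψ
  have h2 := LinearMap.BilinForm.finrank_orthogonal hnd (LinearMap.ker Ψ)
  rw [hperp] at h2
  omega

/-- If the members of an independent family contain those of another family, the latter are
determined by their supremum. -/
theorem inf_iSup_eq_of_iSupIndep {ι E : Type*} [AddCommGroup E] [Module ℂ E]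
    {p q : ι → Submodule ℂ E} (hp : iSupIndep p) (hq : q ≤ p) (i : ι) : p i ⊓ ⨆ j, q j = q i := by
  refine le_antisymm ?_ (le_inf (hq i) (le_iSup q i))
  have h1 : ⨆ j, q j ≤ q i ⊔ ⨆ (j) (_ : j ≠ i), p j := by
    refine iSup_le fun j => ?_
    by_cases h : j = i
    · exact h ▸ le_sup_left
    · exact le_sup_of_le_right ((hq j).trans (le_iSup₂_of_le j h le_rfl))
  calc p i ⊓ ⨆ j, q j ≤ (q i ⊔ ⨆ (j) (_ : j ≠ i), p j) ⊓ p i := by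
        rw [inf_comm]
        exact inf_le_inf_right _ h1
    -- The modular law, available because `q i ≤ p i`.
    _ = q i ⊔ (⨆ (j) (_ : j ≠ i), p j) ⊓ p i := (sup_inf_assoc_of_le _ (hq i)).symm ▸ rfl
    _ = q i := by rw [inf_comm, (hp i).eq_bot, sup_bot_eq]

/-! ### Symmetric polynomials of bounded degree in each variable -/

/-- The homogeneous symmetric polynomials of degree `D` whose exponents are all less than `b`. -/
def boundedSym (k b D : ℕ) : Submodule ℂ (MvPolynomial (Fin k) ℂ) where
  carrier := {g | g.IsSymmetric ∧ g.IsHomogeneous D ∧ ∀ r, coeff r g ≠ 0 → ∀ i, r i < b}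
  add_mem' := by
    rintro f g ⟨hf1, hf2, hf3⟩ ⟨hg1, hg2, hg3⟩
    refine ⟨hf1.add hg1, hf2.add hg2, fun r hr i => ?_⟩
    by_cases h : coeff r f = 0
    · rw [coeff_add, h, zero_add] at hr
      exact hg3 r hr i
    · exact hf3 r h i
  zero_mem' := ⟨IsSymmetric.zero, isHomogeneous_zero _ _ _, fun r hr => by simp at hr⟩
  smul_mem' c := by
    rintro f ⟨hf1, hf2, hf3⟩
    refine ⟨hf1.smul c, ?_, fun r hr => hf3 r fun h => hr (by rw [coeff_smul, h, smul_zero])⟩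
    rw [smul_eq_C_mul]
    exact hf2.C_mul c

/-- The monotone functions `Fin k → ℕ` with values less than `b` and with sum `D`. -/
def monoFuns (k b D : ℕ) : Finset (Fin k → ℕ) :=
  by classical exact (Fintype.piFinset fun _ => range b).filter fun r => Monotone r ∧ ∑ i, r i = D

theorem mem_monoFuns {k b D : ℕ} {r : Fin k → ℕ} :
    r ∈ monoFuns k b D ↔ (∀ i, r i < b) ∧ Monotone r ∧ ∑ i, r i = D := by
  simp [monoFuns]

theorem weight_one_eq_sum {k : ℕ} (r : Fin k →₀ ℕ) :
    Finsupp.weight (1 : Fin k → ℕ) r = ∑ i, r i := by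
  rw [← Finsupp.degree_eq_sum, Finsupp.degree_eq_weight_one]
  rfl

/-- A function on a finite type as a finitely supported function. -/
abbrev toFs {k : ℕ} (r : Fin k → ℕ) : Fin k →₀ ℕ := Finsupp.equivFunOnFinite.symm r

theorem coeff_perm {k : ℕ} {g : MvPolynomial (Fin k) ℂ} (hg : g.IsSymmetric) (r : Fin k → ℕ)
    (σ : Equiv.Perm (Fin k)) : coeff (toFs (r ∘ σ)) g = coeff (toFs r) g := by
  have h := coeff_rename_mapDomain σ σ.injective g (toFs (r ∘ σ))
  rw [hg σ] at h
  rw [← h]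
  congr 1
  ext i
  rw [← Equiv.apply_symm_apply σ i, Finsupp.mapDomain_apply σ.injective]
  simp

/-- Evaluation of the coefficients at the monotone exponents. -/
def monoCoeff (k b D : ℕ) : boundedSym k b D →ₗ[ℂ] (monoFuns k b D → ℂ) where
  toFun g r := coeff (toFs r.1) g.1
  map_add' _ _ := by ext; simp
  map_smul' _ _ := by ext; simp

/-- Every orbit of exponents under permutation has exactly one monotone member, so a symmetric
polynomial amounts to a free choice of coefficients there. -/
theorem monoCoeff_bijective (k b D : ℕ) : Function.Bijective (monoCoeff k b D) := by
  classical
  constructor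
  · rw [← LinearMap.ker_eq_bot, LinearMap.ker_eq_bot']
    rintro ⟨g, hg1, hg2, hg3⟩ h
    ext r
    rw [Submodule.coe_zero, coeff_zero]
    by_contra hr
    set r' : Fin k → ℕ := r ∘ Tuple.sort r with hr'
    have h1 : coeff (toFs r') g = coeff r g := by
      rw [hr', coeff_perm hg1]
      congr 1
      exact Finsupp.equivFunOnFinite.symm_apply_apply r
    have h2 : r' ∈ monoFuns k b D := by
      rw [mem_monoFuns]
      refine ⟨fun i => hg3 r hr _, Tuple.monotone_sort r, ?_⟩
      have h3 := hg2 hr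
      rw [weight_one_eq_sum] at h3
      rw [← h3]
      exact Equiv.sum_comp (Tuple.sort r) r
    have h4 := congrFun h ⟨r', h2⟩
    exact hr (h1 ▸ h4)
  · intro φ
    -- The extension of `φ` constant along orbits, obtained by sorting the exponent first.
    let φ' : (Fin k → ℕ) → ℂ := fun r => if h : r ∘ Tuple.sort r ∈ monoFuns k b D
      then φ ⟨_, h⟩ else 0
    have hφ' : ∀ (r : Fin k → ℕ) (σ : Equiv.Perm (Fin k)), φ' (r ∘ σ) = φ' r := by
      intro r σ
      simp only [φ']
      simp only [Tuple.comp_perm_comp_sort_eq_comp_sort]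
    have hsupp : ∀ r, φ' r ≠ 0 → (∀ i, r i < b) ∧ ∑ i, r i = D := by
      intro r hr
      have h : r ∘ Tuple.sort r ∈ monoFuns k b D := by
        by_contra h
        exact hr (dif_neg h)
      rw [mem_monoFuns] at h
      refine ⟨fun i => ?_, ?_⟩
      · simpa using h.1 ((Tuple.sort r).symm i)
      · rw [← h.2.2]
        exact (Equiv.sum_comp (Tuple.sort r) r).symm
    let g : MvPolynomial (Fin k) ℂ :=
      ∑ r ∈ Fintype.piFinset fun _ : Fin k => range b, monomial (toFs r) (φ' r)
    have hg : ∀ r : Fin k → ℕ, coeff (toFs r) g = φ' r := by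
      intro r
      simp only [g, coeff_sum, coeff_monomial, EmbeddingLike.apply_eq_iff_eq]
      rw [Finset.sum_ite_eq']
      split_ifs with h
      · rfl
      · by_contra h0
        refine h ?_
        rw [Fintype.mem_piFinset]
        exact fun i => mem_range.mpr ((hsupp r (Ne.symm h0)).1 i)
    have hg' : ∀ r : Fin k →₀ ℕ, coeff r g = φ' r := fun r => by
      rw [← hg]
      congr 1
      exact (Finsupp.equivFunOnFinite.symm_apply_apply r).symm
    have hmem : g ∈ boundedSym k b D := by
      refine ⟨fun σ => ?_, ?_, fun r hr => ?_⟩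
      · ext r
        have h1 := coeff_rename_mapDomain σ σ.injective g (toFs (r ∘ σ))
        have h2 : Finsupp.mapDomain σ (toFs (r ∘ σ)) = r := by
          ext i
          rw [← Equiv.apply_symm_apply σ i, Finsupp.mapDomain_apply σ.injective]
          simp
        rw [h2, hg, hφ'] at h1
        rw [h1, hg']
      · intro r hr
        rw [hg'] at hr
        rw [weight_one_eq_sum]
        exact (hsupp r hr).2
      · rw [hg'] at hr
        exact (hsupp r hr).1
    refine ⟨⟨g, hmem⟩, ?_⟩
    ext ⟨r, hr⟩
    change coeff (toFs r) g = _
    rw [hg]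
    have hs : r ∘ Tuple.sort r = r := by
      rw [Tuple.sort_eq_refl_iff_monotone.mpr (mem_monoFuns.mp hr).2.1]
      rfl
    simp only [φ', hs, hr, dif_pos]

theorem finrank_boundedSym (k b D : ℕ) : Module.finrank ℂ (boundedSym k b D) = #(monoFuns k b D) := by
  rw [(LinearEquiv.ofBijective _ (monoCoeff_bijective k b D)).finrank_eq]
  simp

/-! ### Counting monotone functions -/

theorem monoFuns_zero (b D : ℕ) : #(monoFuns 0 b D) = if D = 0 then 1 else 0 := by
  split_ifs with h
  · rw [Finset.card_eq_one]
    refine ⟨Fin.elim0, ?_⟩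
    ext r
    rw [mem_monoFuns, Finset.mem_singleton]
    subst h
    simp [Subsingleton.elim r Fin.elim0, Subsingleton.monotone]
  · rw [Finset.card_eq_zero]
    ext r
    simp [mem_monoFuns, Ne.symm h]

theorem monoFuns_bound_zero (k D : ℕ) : #(monoFuns (k + 1) 0 D) = 0 := by
  rw [Finset.card_eq_zero]
  ext r
  simp [mem_monoFuns]

/-- The q-Pascal rule: either the smallest value is 0 and can be deleted, or all k+1 values are
positive and can be lowered by 1. -/
theorem card_monoFuns_succ (k b D : ℕ) : #(monoFuns (k + 1) (b + 1) D)
    = #(monoFuns k (b + 1) D) + if k + 1 ≤ D then #(monoFuns (k + 1) b (D - (k + 1))) else 0 := by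
  classical
  rw [← Finset.card_filter_add_card_filter_not (s := monoFuns (k + 1) (b + 1) D) (fun r => r 0 = 0)]
  congr 1
  · refine Finset.card_bij' (fun r _ => fun i => r i.succ) (fun r _ => Fin.cons 0 r) ?_ ?_ ?_ ?_
    · intro r hr
      rw [Finset.mem_filter, mem_monoFuns] at hr
      rw [mem_monoFuns]
      refine ⟨fun i => hr.1.1 _, fun i j hij => hr.1.2.1 (Fin.succ_le_succ_iff.mpr hij), ?_⟩
      rw [← hr.1.2.2, Fin.sum_univ_succ, hr.2, zero_add]
    · intro r hr
      rw [mem_monoFuns] at hr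
      rw [Finset.mem_filter, mem_monoFuns]
      refine ⟨⟨fun i => ?_, fun i j hij => ?_, ?_⟩, rfl⟩
      · cases i using Fin.cases with
        | zero => simp
        | succ i => simpa using hr.1 i
      · cases i using Fin.cases with
        | zero => simp
        | succ i =>
          cases j using Fin.cases with
          | zero => simp at hij
          | succ j => simpa using hr.2.1 (Fin.succ_le_succ_iff.mp hij)
      · rw [Fin.sum_univ_succ]
        simpa using hr.2.2
    · intro r hr
      rw [Finset.mem_filter] at hr
      ext i
      cases i using Fin.cases with
      | zero => simp [hr.2]
      | succ i => simp
    · intro r _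
      ext i
      simp
  · split_ifs with hD
    · refine Finset.card_bij' (fun r _ => fun i => r i - 1) (fun r _ => fun i => r i + 1) ?_ ?_ ?_ ?_
      · intro r hr
        rw [Finset.mem_filter, mem_monoFuns] at hr
        have hpos : ∀ i, 1 ≤ r i := fun i =>
          (Nat.one_le_iff_ne_zero.mpr hr.2).trans (hr.1.2.1 (Fin.zero_le i))
        rw [mem_monoFuns]
        refine ⟨fun i => ?_, fun i j hij => Nat.sub_le_sub_right (hr.1.2.1 hij) 1, ?_⟩
        · have := hr.1.1 i
          have := hpos i
          omega
        · have h1 : ∑ i, r i = ∑ i, (r i - 1) + ∑ _i : Fin (k + 1), 1 := by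
            rw [← Finset.sum_add_distrib]
            exact Finset.sum_congr rfl fun i _ => (Nat.sub_add_cancel (hpos i)).symm
          simp only [sum_const, card_univ, Fintype.card_fin, smul_eq_mul, mul_one] at h1
          omega
      · intro r hr
        rw [mem_monoFuns] at hr
        rw [Finset.mem_filter, mem_monoFuns]
        refine ⟨⟨fun i => by have := hr.1 i; omega, fun i j hij => Nat.succ_le_succ (hr.2.1 hij), ?_⟩,
          by simp⟩
        rw [Finset.sum_add_distrib, hr.2.2]
        simp
        omega
      · intro r hr
        rw [Finset.mem_filter, mem_monoFuns] at hr
        ext i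
        exact Nat.sub_add_cancel
          ((Nat.one_le_iff_ne_zero.mpr hr.2).trans (hr.1.2.1 (Fin.zero_le i)))
      · intro r _
        ext i
        simp
    · rw [Finset.card_eq_zero, Finset.filter_eq_empty_iff]
      intro r hr h0
      rw [mem_monoFuns] at hr
      have h1 : ∑ _i : Fin (k + 1), 1 ≤ ∑ i, r i := Finset.sum_le_sum fun i _ =>
        (Nat.one_le_iff_ne_zero.mpr h0).trans (hr.2.1 (Fin.zero_le i))
      simp only [sum_const, card_univ, Fintype.card_fin, smul_eq_mul, mul_one] at h1
      omega

theorem card_monoFuns (k b D : ℕ) :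
    (#(monoFuns k b D) : ℤ) = (qBinom (b + k - 1) k).coeff D := by
  induction k generalizing b D with
  | zero =>
    rw [monoFuns_zero, qBinom, Polynomial.coeff_one]
    push_cast
    rfl
  | succ k ihk =>
    induction b generalizing D with
    | zero => rw [monoFuns_bound_zero, qBinom_of_lt _ _ (by omega)]; simp
    | succ b ihb =>
      rw [card_monoFuns_succ, show b + 1 + (k + 1) - 1 = (b + k) + 1 by omega, qBinom,
        Polynomial.coeff_add, Polynomial.coeff_X_pow_mul', Nat.cast_add, ihk]
      congr 1
      · rw [show b + 1 + k - 1 = b + k by omega]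
      · split_ifs
        · rw [ihb]; rfl
        · rfl

/-! ### The dual of the homogeneous components of the coinvariants -/

/-- The exponents of total degree `N`. -/
abbrev expo (k N : ℕ) : Finset (Fin k →₀ ℕ) := (univ : Finset (Fin k)).finsuppAntidiag N

theorem mem_expo {k N : ℕ} {r : Fin k →₀ ℕ} : r ∈ expo k N ↔ ∑ i, r i = N := by
  simp [mem_finsuppAntidiag]

/-- The first exponent exists and is at least `n`. -/
def IsBad (n : ℕ) : {k : ℕ} → (Fin k →₀ ℕ) → Prop
  | 0, _ => False
  | _ + 1, r => n ≤ r 0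

theorem isSymmetric_homogeneousComponent {k : ℕ} {g : MvPolynomial (Fin k) ℂ} (hg : g.IsSymmetric)
    (D : ℕ) : (homogeneousComponent D g).IsSymmetric := by
  intro σ
  rw [rename_homogeneousComponent, hg σ]

/-- In degree N only the component of `g` of degree D can contribute, so symmetric multipliers may
be taken homogeneous. -/
theorem coeff_mul_homogeneous {k D d N : ℕ} (g : MvPolynomial (Fin k) ℂ)
    {p : MvPolynomial (Fin k) ℂ} (hp : p.IsHomogeneous d) (hN : D + d = N) {r : Fin k →₀ ℕ}
    (hr : r ∈ expo k N) : coeff r (g * p) = coeff r (homogeneousComponent D g * p) := by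
  rw [coeff_mul, coeff_mul]
  refine Finset.sum_congr rfl fun x hx => ?_
  rw [HasAntidiagonal.mem_antidiagonal] at hx
  rw [coeff_homogeneousComponent]
  split_ifs with h
  · rfl
  · have h1 : coeff x.2 p = 0 := by
      by_contra h0
      have h2 := hp h0
      rw [weight_one_eq_sum] at h2
      rw [mem_expo, ← hx] at hr
      simp only [Finsupp.coe_add, Pi.add_apply, Finset.sum_add_distrib] at hr
      rw [Finsupp.degree_eq_sum] at h
      omega
    rw [h1, mul_zero, mul_zero]

/-- Multiplication by `discr m k`, followed by the restriction to the coefficients of degree `N`. -/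
def mulDiscr (m k N : ℕ) : MvPolynomial (Fin k) ℂ →ₗ[ℂ] (expo k N → ℂ) where
  toFun g r := coeff r.1 (g * discr m k)
  map_add' _ _ := by ext; simp [add_mul]
  map_smul' _ _ := by ext; simp

/-- The coefficients in degree `N` of the symmetric multiples of `discr m k`. -/
def symMultiples (m k N : ℕ) : Submodule ℂ (expo k N → ℂ) :=
  (Subalgebra.toSubmodule (symmetricSubalgebra (Fin k) ℂ)).map (mulDiscr m k N)

/-- Degrees in X_0 add under multiplication, so the condition bounds the X_0-degree of `g`; symmetry
carries the bound to every variable. -/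
theorem bounded_iff {m k n D N : ℕ} (hN : D + m * (k * (k - 1)) = N) {g : MvPolynomial (Fin k) ℂ}
    (hg : g.IsSymmetric) (hD : g.IsHomogeneous D) :
    (∀ r ∈ expo k N, IsBad n r → coeff r (g * discr m k) = 0) ↔
      ∀ r, coeff r g ≠ 0 → ∀ i, r i < n - 2 * m * (k - 1) := by
  by_cases hg0 : g = 0
  · simp [hg0]
  cases k with
  | zero => exact ⟨fun _ _ _ i => i.elim0, fun _ _ _ h => h.elim⟩
  | succ k =>
    have hne : g * discr m (k + 1) ≠ 0 := mul_ne_zero hg0 (discr_ne_zero _ _)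
    have hdeg : degreeOf 0 (g * discr m (k + 1)) = degreeOf 0 g + 2 * m * k := by
      rw [degreeOf_mul_eq hg0 (discr_ne_zero _ _), degreeOf_zero_discr]
    have hmem : ∀ r, coeff r (g * discr m (k + 1)) ≠ 0 → r ∈ expo (k + 1) N := by
      intro r hr
      rw [mem_expo, ← weight_one_eq_sum, ← hN]
      exact hD.mul (discr_isHomogeneous m (k + 1)) hr
    rw [Nat.add_sub_cancel]
    constructor
    · intro h r hr i
      have h1 : ∀ s ∈ (g * discr m (k + 1)).support, s 0 < n := by
        intro s hs
        rw [mem_support_iff] at hs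
        by_contra h0
        exact hs (h s (hmem s hs) (by simpa [IsBad] using h0))
      -- `degreeOf_lt_iff` needs a positive bound; a monomial of the nonzero product provides it.
      have hn : 0 < n := by
        obtain ⟨s, hs⟩ := support_nonempty.mpr hne
        exact (Nat.zero_le _).trans_lt (h1 s hs)
      have h2 := (degreeOf_lt_iff hn).mpr h1
      have h3 := coeff_perm hg r (Equiv.swap 0 i)
      have h4 : coeff (toFs (r ∘ Equiv.swap 0 i)) g ≠ 0 := by
        rw [h3]
        convert hr using 2
        exact Finsupp.equivFunOnFinite.symm_apply_apply r
      have h5 := monomial_le_degreeOf 0 (mem_support_iff.mpr h4)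
      simp only [Finsupp.equivFunOnFinite_symm_apply_apply, Function.comp_apply,
        Equiv.swap_apply_left] at h5
      omega
    · intro h r hr hb
      by_contra h0
      have h1 := monomial_le_degreeOf 0 (mem_support_iff.mpr h0)
      obtain ⟨s, hs⟩ := support_nonempty.mpr hg0
      have h2 := h s (mem_support_iff.mp hs) 0
      have h3 := (degreeOf_lt_iff (n := 0) (f := g) (show 0 < n - 2 * m * k by omega)).mpr
        fun s hs => h s (mem_support_iff.mp hs) 0
      have hb' : n ≤ r 0 := hb
      omega

theorem finrank_symMultiples_inf (m k n N : ℕ) :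
    Module.finrank ℂ ↥(symMultiples m k N ⊓ vanishing {r | IsBad n r.1})
      = if m * (k * (k - 1)) ≤ N
        then #(monoFuns k (n - 2 * m * (k - 1)) (N - m * (k * (k - 1)))) else 0 := by
  split_ifs with hN
  · obtain ⟨D, rfl⟩ := Nat.exists_eq_add_of_le' hN
    rw [Nat.add_sub_cancel, ← finrank_boundedSym]
    have hinj : Function.Injective ((mulDiscr m k (D + m * (k * (k - 1)))).domRestrict
        (boundedSym k (n - 2 * m * (k - 1)) D)) := by
      rw [← LinearMap.ker_eq_bot, LinearMap.ker_eq_bot']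
      rintro ⟨g, hg⟩ h
      rw [Submodule.mk_eq_zero]
      have h1 : g * discr m k = 0 := by
        ext r
        by_contra h0
        have h2 := hg.2.1.mul (discr_isHomogeneous m k) h0
        rw [weight_one_eq_sum] at h2
        exact h0 (congrFun h ⟨r, mem_expo.mpr h2⟩)
      exact (mul_eq_zero.mp h1).resolve_right (discr_ne_zero m k)
    rw [← LinearMap.finrank_range_of_inj hinj]
    refine congrArg (fun p : Submodule ℂ _ => Module.finrank ℂ p) (le_antisymm ?_ ?_)
    · rintro w ⟨⟨g, hg, rfl⟩, hw⟩
      have hg' := isSymmetric_homogeneousComponent hg D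
      have hcoeff : ∀ r ∈ expo k (D + m * (k * (k - 1))), coeff r (g * discr m k)
          = coeff r (homogeneousComponent D g * discr m k) := fun r hr =>
        coeff_mul_homogeneous g (discr_isHomogeneous m k) rfl hr
      refine ⟨⟨homogeneousComponent D g, hg', homogeneousComponent_isHomogeneous D g,
        (bounded_iff rfl hg' (homogeneousComponent_isHomogeneous D g)).mp fun r hr hb => ?_⟩, ?_⟩
      · rw [← hcoeff r hr]
        exact hw ⟨r, hr⟩ hb
      · ext r
        exact (hcoeff r.1 r.2).symm
    · rintro w ⟨⟨g, hg⟩, rfl⟩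
      exact ⟨⟨g, hg.1, rfl⟩, fun r hb => (bounded_iff rfl hg.1 hg.2.1).mpr hg.2.2 r.1 r.2 hb⟩
  · have h1 : symMultiples m k N = ⊥ := by
      rw [eq_bot_iff]
      rintro w ⟨g, _, rfl⟩
      rw [Submodule.mem_bot]
      ext r
      change coeff r.1 (g * discr m k) = 0
      rw [coeff_mul]
      refine Finset.sum_eq_zero fun x hx => ?_
      rw [HasAntidiagonal.mem_antidiagonal] at hx
      by_contra h0
      have h2 := discr_isHomogeneous m k (right_ne_zero_of_mul h0)
      rw [weight_one_eq_sum] at h2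
      have h3 := mem_expo.mp r.2
      rw [← hx] at h3
      simp only [Finsupp.coe_add, Pi.add_apply, Finset.sum_add_distrib] at h3
      omega
    rw [h1, bot_inf_eq, finrank_bot]

theorem sum_smul_fockWord_eq_zero_iff_symMultiples {m : ℕ} (hm : 1 ≤ m) {k N : ℕ}
    (c : expo k N → ℂ) : ∑ r, c r • fockWord m k r.1 = 0 ↔
      ∀ w ∈ symMultiples m k N, ∑ r, c r * w r = 0 := by
  rw [sum_smul_fockWord_eq_zero_iff hm c fun r => r.1]
  constructor
  · rintro h w ⟨g, hg, rfl⟩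
    exact h g hg
  · exact fun h g hg => h _ ⟨g, hg, rfl⟩

/-! ### Joint eigenspaces -/

/-- Pairs differing from `e` in the first entry are separated by `H`, those agreeing there by `L`.
The two operators need not commute. -/
theorem iSupIndep_inf_eigenspace {E : Type*} [AddCommGroup E] [Module ℂ E] (H L : Module.End ℂ E) :
    iSupIndep fun e : ℂ × ℂ => H.eigenspace e.1 ⊓ L.eigenspace e.2 := by
  intro e
  rw [Submodule.disjoint_def]
  intro x hx hx'
  have h1 : ⨆ (e' : ℂ × ℂ) (_ : e' ≠ e), H.eigenspace e'.1 ⊓ L.eigenspace e'.2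
      ≤ (⨆ (a) (_ : a ≠ e.1), H.eigenspace a)
        ⊔ (H.eigenspace e.1 ⊓ ⨆ (b) (_ : b ≠ e.2), L.eigenspace b) := by
    refine iSup₂_le fun e' he' => ?_
    by_cases h : e'.1 = e.1
    · refine le_sup_of_le_right (le_inf (h ▸ inf_le_left) ?_)
      exact inf_le_right.trans (le_iSup₂_of_le e'.2 (fun h' => he' (Prod.ext h h')) le_rfl)
    · exact le_sup_of_le_left (inf_le_left.trans (le_iSup₂_of_le e'.1 h le_rfl))
  obtain ⟨y, hy, z, hz, rfl⟩ := Submodule.mem_sup.mp (h1 hx')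
  have hy0 : y = 0 := by
    have h2 : y ∈ H.eigenspace e.1 := by
      have := Submodule.sub_mem _ hx.1 hz.1
      simpa using this
    exact Submodule.disjoint_def.mp (H.eigenspaces_iSupIndep e.1) y h2 hy
  subst hy0
  rw [zero_add] at hx ⊢
  exact Submodule.disjoint_def.mp (L.eigenspaces_iSupIndep e.2) z hx.2 hz.2

/-! ### Words span the principal subspace -/

/-- The vector `a_{-m-r_0} a_{-m-r_1} ⋯ a_{-m-r_{k-1}} v_{1-m}`. -/
def word (m k : ℕ) (r : Fin k →₀ ℕ) : Total := incl ((m : ℤ) - 1 + 2 * m * k) (fockWord m k r)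

theorem word_zero (m : ℕ) (r : Fin 0 →₀ ℕ) : word m 0 r = v (1 - m) := by
  rw [word, v, fockWord]
  congr 2
  push_cast
  ring

/-- On the summand j = m-1+2mk, the operator a_{-m-s} uses the vertex coefficient of index (m+s)-1-j
= s-2mk, the one built into `fockWord`. -/
theorem a_word (m k : ℕ) (s : ℕ) (r : Fin k →₀ ℕ) :
    a m (-m - s) (word m k r) = word m (k + 1) (Finsupp.cons s r) := by
  rw [word, a, onSummands_incl, LinearMap.comp_apply, word, fockWord, Finsupp.cons_zero,
    Finsupp.tail_cons]
  congr 2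
  · push_cast
    ring
  · congr 1
    ring

theorem a_word_of_le (m k : ℕ) {i : ℤ} (hi : i ≤ -m) (r : Fin k →₀ ℕ) :
    a m i (word m k r) = word m (k + 1) (Finsupp.cons (-m - i).toNat r) := by
  rw [← a_word]
  congr 2
  omega

theorem word_mem_V (m k : ℕ) (r : Fin k →₀ ℕ) : word m k r ∈ V m := by
  induction k with
  | zero => exact ⟨1, Subalgebra.one_mem _, (word_zero m r).symm⟩
  | succ k ih =>
    obtain ⟨T, hT, hTr⟩ := ih r.tail
    rw [← Finsupp.cons_tail r, ← a_word, ← hTr]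
    exact ⟨a m (-m - r 0) * T, Subalgebra.mul_mem _ (Algebra.subset_adjoin
      ⟨_, by omega, rfl⟩) hT, rfl⟩

theorem V_eq_span (m : ℕ) :
    V m = Submodule.span ℂ (Set.range fun x : Σ k, Fin k →₀ ℕ => word m x.1 x.2) := by
  apply le_antisymm
  · rintro _ ⟨T, hT, rfl⟩
    set Q := Submodule.span ℂ (Set.range fun x : Σ k, Fin k →₀ ℕ => word m x.1 x.2) with hQ
    have key : ∀ w ∈ Q, T w ∈ Q := by
      replace hT : T ∈ Algebra.adjoin ℂ {T | ∃ i : ℤ, i ≤ 1 - m - 1 ∧ T = a m i} := hT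
      induction hT using Algebra.adjoin_induction with
      | mem T hT =>
        obtain ⟨i, hi, rfl⟩ := hT
        intro w hw
        induction hw using Submodule.span_induction with
        | mem w hw =>
          obtain ⟨x, rfl⟩ := hw
          simp only
          rw [a_word_of_le m x.1 (by omega)]
          exact Submodule.subset_span ⟨⟨_, _⟩, rfl⟩
        | zero => simp
        | add x y _ _ hx hy => rw [map_add]; exact Submodule.add_mem _ hx hy
        | smul c x _ hx => rw [map_smul]; exact Submodule.smul_mem _ _ hx
      | algebraMap c =>
        intro w hw
        rw [Module.algebraMap_end_apply]
        exact Submodule.smul_mem _ _ hw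
      | add x y _ _ hx hy => exact fun w hw => Submodule.add_mem _ (hx w hw) (hy w hw)
      | mul x y _ _ hx hy => exact fun w hw => hx _ (hy w hw)
    exact key _ (Submodule.subset_span ⟨⟨0, 0⟩, word_zero m 0⟩)
  · rw [Submodule.span_le]
    rintro _ ⟨x, rfl⟩
    exact word_mem_V m x.1 x.2

theorem iSup_map_a_eq_span (m n : ℕ) : (⨆ i : {i : ℤ // i ≤ -(m : ℤ) - n}, (V m).map (a m i))
    = Submodule.span ℂ {w | ∃ (k : ℕ) (r : Fin k →₀ ℕ), IsBad n r ∧ w = word m k r} := by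
  apply le_antisymm
  · refine iSup_le fun i => ?_
    rw [V_eq_span, Submodule.map_span, Submodule.span_le]
    rintro _ ⟨_, ⟨x, rfl⟩, rfl⟩
    have hi := i.2
    refine Submodule.subset_span ⟨x.1 + 1, _, ?_, a_word_of_le m x.1 (by omega) x.2⟩
    simp only [IsBad, Finsupp.cons_zero]
    omega
  · rw [Submodule.span_le]
    rintro _ ⟨k, r, hr, rfl⟩
    cases k with
    | zero => exact hr.elim
    | succ k =>
      have hr' : n ≤ r 0 := hr
      refine Submodule.mem_iSup_of_mem ⟨-m - r 0, by omega⟩ ?_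
      refine ⟨word m k r.tail, word_mem_V m k _, ?_⟩
      rw [a_word, Finsupp.cons_tail]

/-! ### The bidegree of a word -/

theorem fockEnergy_monomial (e : ℕ →₀ ℕ) (c : ℂ) :
    fockEnergy (monomial e c) = (wt e : ℂ) • monomial e c := by
  change ∑ᶠ k : ℕ, (create k * annih k) (monomial e c : Fock) = _
  have h : ∀ k : ℕ, (create k * annih k) (monomial e c : Fock)
      = ((e k * (k + 1) : ℕ) : ℂ) • monomial e c := by
    intro k
    rw [Module.End.mul_apply, annih, LinearMap.smul_apply, Derivation.coeFn_coe, pderiv_monomial,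
      map_smul, create, LinearMap.mulLeft_apply]
    by_cases hk : e k = 0
    · simp [hk]
    · rw [X, monomial_mul, add_comm (Finsupp.single k 1), Finsupp.sub_add_single_one_cancel hk,
        smul_monomial, smul_monomial]
      congr 1
      push_cast
      simp only [smul_eq_mul]
      ring
  simp only [h]
  rw [finsum_eq_sum_of_support_subset (s := e.support), ← Finset.sum_smul, Finsupp.weight_apply,
    Finsupp.sum]
  · push_cast
    simp
  · intro k hk
    by_contra h0
    refine hk ?_
    have : e k = 0 := by simpa using h0
    simp [this]

/-- All monomials of a word have weight ∑ r_i minus the degree mk(k-1) of Δ. -/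
theorem fockEnergy_fockWord {m : ℕ} (hm : 1 ≤ m) (k : ℕ) (r : Fin k →₀ ℕ) :
    fockEnergy (fockWord m k r)
      = (((∑ i, r i : ℕ) : ℂ) - m * (k * (k - 1))) • fockWord m k r := by
  conv_lhs => rw [← support_sum_monomial_coeff (fockWord m k r)]
  conv_rhs => rw [← support_sum_monomial_coeff (fockWord m k r)]
  rw [map_sum, Finset.smul_sum]
  refine Finset.sum_congr rfl fun μ hμ => ?_
  rw [fockEnergy_monomial]
  congr 1
  have h := degree_of_coeff_fockWord_ne_zero hm (mem_support_iff.mp hμ)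
  rw [Finsupp.degree_eq_sum] at h
  rw [h]
  cases k with
  | zero => simp
  | succ k => push_cast; simp

/-- The bidegree of the words of length `k` with exponents of sum `N`. -/
def bideg (m k N : ℕ) : ℂ × ℂ :=
  (degZ m (1 - m) + k * sqrtTwo m, degQ m (1 - m) + ((m * k + N : ℕ) : ℂ))

theorem bideg_injective {m : ℕ} (hm : 1 ≤ m) {k k' N N' : ℕ} (h : bideg m k N = bideg m k' N') :
    k = k' ∧ N = N' := by
  rw [bideg, bideg, Prod.mk.injEq, add_right_inj, add_right_inj, Nat.cast_inj] at h
  have h1 : k = k' := by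
    have := mul_right_cancel₀ (sqrtTwo_ne_zero hm) h.1
    exact_mod_cast this
  subst h1
  exact ⟨rfl, by omega⟩

theorem h0_incl (m : ℕ) (j : ℤ) (f : Fock) : h0 m (incl j f) = ((j : ℂ) / sqrtTwo m) • incl j f := by
  rw [h0, onSummands_incl, LinearMap.smul_apply]

theorem word_mem_bidegree {m : ℕ} (hm : 1 ≤ m) (k : ℕ) (r : Fin k →₀ ℕ) :
    word m k r ∈ bidegree m (bideg m k (∑ i, r i)) := by
  have hs := sqrtTwo_mul_self m
  have hs0 := sqrtTwo_ne_zero hm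
  have hm0 : (m : ℂ) ≠ 0 := by exact_mod_cast (by omega : m ≠ 0)
  have hm' : (m : ℂ) = sqrtTwo m * sqrtTwo m / 2 := by rw [hs]; ring
  rw [bidegree, Submodule.mem_inf, Module.End.mem_eigenspace_iff, Module.End.mem_eigenspace_iff]
  constructor
  · rw [word, h0_incl]
    congr 1
    simp only [bideg, degZ]
    field_simp
    push_cast
    rw [sq, hs]
    ring
  · rw [word, L0]
    simp only [LinearMap.sub_apply, LinearMap.add_apply, LinearMap.smul_apply,
      Module.End.mul_apply, h0_incl, map_smul, onSummands_incl, LinearMap.comp_apply,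
      fockEnergy_fockWord hm, smul_smul, ← sub_smul, ← add_smul]
    congr 1
    simp only [bideg, degQ]
    have e1 : ∀ x y : ℂ, x / sqrtTwo m * (y / sqrtTwo m) = x * y / (2 * m) := by
      intro x y
      rw [div_mul_div_comm, hs]
    rw [mul_assoc, e1, e1]
    push_cast
    field_simp
    ring

/-! ### The graded components of the coinvariants -/

theorem iSupIndep_bidegree (m : ℕ) : iSupIndep (bidegree m) :=
  iSupIndep_inf_eigenspace (h0 m) (L0 m)

theorem map_span_le_span {E : Type*} [AddCommGroup E] [Module ℂ E] {s : Set E} {T : Module.End ℂ E}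
    (h : ∀ w ∈ s, ∃ c : ℂ, T w = c • w) : ∀ w ∈ Submodule.span ℂ s, T w ∈ Submodule.span ℂ s := by
  intro w hw
  induction hw using Submodule.span_induction with
  | mem w hw =>
    obtain ⟨c, hc⟩ := h w hw
    rw [hc]
    exact Submodule.smul_mem _ _ (Submodule.subset_span hw)
  | zero => simp
  | add x y _ _ hx hy => rw [map_add]; exact Submodule.add_mem _ hx hy
  | smul c x _ hx => rw [map_smul]; exact Submodule.smul_mem _ _ hx

/-- An operator for which all words are eigenvectors descends to the coinvariants. -/
theorem exists_descent {m : ℕ} (n : ℕ) {T : Module.End ℂ Total}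
    (hT : ∀ (k : ℕ) (r : Fin k →₀ ℕ), ∃ c : ℂ, T (word m k r) = c • word m k r) :
    ∃ T' : Module.End ℂ (Coinv m n), ∀ (x : V m) (c : ℂ), T x = c • (x : Total) →
      T' ((coinvariantKernel m n).mkQ x) = c • (coinvariantKernel m n).mkQ x := by
  have hV : ∀ w ∈ V m, T w ∈ V m := by
    rw [V_eq_span]
    refine map_span_le_span ?_
    rintro _ ⟨x, rfl⟩
    exact hT x.1 x.2
  have hK : coinvariantKernel m n ≤ (coinvariantKernel m n).comap (T.restrict hV) := by
    intro x hx
    rw [coinvariantKernel, Submodule.mem_comap, iSup_map_a_eq_span] at hx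
    rw [Submodule.mem_comap, coinvariantKernel, Submodule.mem_comap, iSup_map_a_eq_span]
    refine map_span_le_span ?_ _ hx
    rintro _ ⟨k, r, _, rfl⟩
    exact hT k r
  refine ⟨(coinvariantKernel m n).mapQ _ (T.restrict hV) hK, fun x c hx => ?_⟩
  change (coinvariantKernel m n).mkQ (T.restrict hV x) = _
  rw [← map_smul]
  congr 1
  exact Subtype.ext hx

/-- h_0 and L_0 descend to the quotient, and the pieces lie in joint eigenspaces of the descended
operators. -/
theorem iSupIndep_coinvPiece {m : ℕ} (hm : 1 ≤ m) (n : ℕ) : iSupIndep (coinvPiece m n) := by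
  obtain ⟨H, hH⟩ := exists_descent (m := m) n (T := h0 m) fun k r =>
    ⟨_, Module.End.mem_eigenspace_iff.mp (word_mem_bidegree hm k r).1⟩
  obtain ⟨L, hL⟩ := exists_descent (m := m) n (T := L0 m) fun k r =>
    ⟨_, Module.End.mem_eigenspace_iff.mp (word_mem_bidegree hm k r).2⟩
  refine (iSupIndep_inf_eigenspace H L).mono fun e => ?_
  rintro _ ⟨x, hx, rfl⟩
  have hx' : (x : Total) ∈ bidegree m e := hx
  exact ⟨Module.End.mem_eigenspace_iff.mpr (hH x _ (Module.End.mem_eigenspace_iff.mp hx'.1)),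
    Module.End.mem_eigenspace_iff.mpr (hL x _ (Module.End.mem_eigenspace_iff.mp hx'.2))⟩

/-- The image of a word in the coinvariants. -/
def coinvWord (m n k : ℕ) (r : Fin k →₀ ℕ) : Coinv m n :=
  (coinvariantKernel m n).mkQ ⟨word m k r, word_mem_V m k r⟩

/-- The span of the images of the words of a given bidegree. -/
def wordPiece (m n : ℕ) (e : ℂ × ℂ) : Submodule ℂ (Coinv m n) :=
  Submodule.span ℂ {w | ∃ (k : ℕ) (r : Fin k →₀ ℕ), bideg m k (∑ i, r i) = e ∧ w = coinvWord m n k r}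

theorem iSup_wordPiece (m n : ℕ) : ⨆ e, wordPiece m n e = ⊤ := by
  rw [eq_top_iff]
  rintro x -
  obtain ⟨⟨y, hy⟩, rfl⟩ := Submodule.mkQ_surjective _ x
  have hy' := hy
  rw [V_eq_span] at hy'
  induction hy' using Submodule.span_induction with
  | mem w hw =>
    obtain ⟨x, rfl⟩ := hw
    exact Submodule.mem_iSup_of_mem _ (Submodule.subset_span ⟨x.1, x.2, rfl, rfl⟩)
  | zero =>
    convert Submodule.zero_mem _
    exact map_zero _
  | add u w hu hw hu' hw' =>
    rw [← V_eq_span] at hu hw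
    exact Submodule.add_mem _ (hu' hu) (hw' hw)
  | smul c u hu hu' =>
    rw [← V_eq_span] at hu
    exact Submodule.smul_mem _ c (hu' hu)

theorem wordPiece_le {m : ℕ} (hm : 1 ≤ m) (n : ℕ) : wordPiece m n ≤ coinvPiece m n := by
  intro e
  rw [wordPiece, Submodule.span_le]
  rintro _ ⟨k, r, rfl, rfl⟩
  exact ⟨_, word_mem_bidegree hm k r, rfl⟩

/-- The word pieces already sum to the whole space, so they must fill the independent pieces that
contain them. -/
theorem coinvPiece_eq {m : ℕ} (hm : 1 ≤ m) (n : ℕ) (e : ℂ × ℂ) :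
    coinvPiece m n e = wordPiece m n e := by
  rw [← inf_iSup_eq_of_iSupIndep (iSupIndep_coinvPiece hm n) (wordPiece_le hm n) e,
    iSup_wordPiece, inf_top_eq]

theorem iSup_coinvPiece {m : ℕ} (hm : 1 ≤ m) (n : ℕ) : ⨆ e, coinvPiece m n e = ⊤ := by
  simp only [coinvPiece_eq hm, iSup_wordPiece]

theorem isInternal_coinvPiece {m : ℕ} (hm : 1 ≤ m) (n : ℕ) :
    DirectSum.IsInternal (coinvPiece m n) :=
  DirectSum.isInternal_submodule_of_iSupIndep_of_iSup_eq_top (iSupIndep_coinvPiece hm n)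
    (iSup_coinvPiece hm n)

theorem coinvPiece_eq_bot {m : ℕ} (hm : 1 ≤ m) (n : ℕ) {e : ℂ × ℂ} (he : ∀ k N, bideg m k N ≠ e) :
    coinvPiece m n e = ⊥ := by
  rw [coinvPiece_eq hm, wordPiece, Submodule.span_eq_bot]
  rintro _ ⟨k, r, h, _⟩
  exact (he _ _ h).elim

theorem incl_injective (j : ℤ) : Function.Injective (incl j) := Finsupp.single_injective j

/-- The linear combinations of the words with exponents of sum `N`, in the coinvariants. -/
def wordComb (m n k N : ℕ) : (expo k N → ℂ) →ₗ[ℂ] Coinv m n :=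
  Fintype.linearCombination ℂ fun r => coinvWord m n k r.1

theorem coinvPiece_bideg {m : ℕ} (hm : 1 ≤ m) (n k N : ℕ) :
    coinvPiece m n (bideg m k N) = LinearMap.range (wordComb m n k N) := by
  rw [coinvPiece_eq hm, wordPiece, wordComb, Fintype.range_linearCombination]
  congr 1
  ext w
  constructor
  · rintro ⟨k', r, h, rfl⟩
    obtain ⟨rfl, hN⟩ := bideg_injective hm h
    exact ⟨⟨r, mem_expo.mpr hN⟩, rfl⟩
  · rintro ⟨r, rfl⟩
    exact ⟨k, r.1, by rw [mem_expo.mp r.2], rfl⟩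

/-- The subspace factored out is spanned by homogeneous words, so its elements of one bidegree need
only the words of that bidegree. -/
theorem mem_iSup_map_a_iff {m : ℕ} (hm : 1 ≤ m) (n k N : ℕ) {x : Total}
    (hx : x ∈ bidegree m (bideg m k N)) :
    (x ∈ ⨆ i : {i : ℤ // i ≤ -(m : ℤ) - n}, (V m).map (a m i)) ↔
      x ∈ Submodule.span ℂ ((fun r : expo k N => word m k r.1) '' {r | IsBad n r.1}) := by
  let q : ℂ × ℂ → Submodule ℂ Total := fun e => Submodule.span ℂ
    {w | ∃ (k : ℕ) (r : Fin k →₀ ℕ), (IsBad n r ∧ bideg m k (∑ i, r i) = e) ∧ w = word m k r}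
  have hq : q ≤ bidegree m := by
    intro e
    refine Submodule.span_le.mpr ?_
    rintro _ ⟨k, r, ⟨_, rfl⟩, rfl⟩
    exact word_mem_bidegree hm k r
  have hsup : (⨆ i : {i : ℤ // i ≤ -(m : ℤ) - n}, (V m).map (a m i)) = ⨆ e, q e := by
    rw [iSup_map_a_eq_span]
    apply le_antisymm
    · refine Submodule.span_le.mpr ?_
      rintro _ ⟨k, r, hr, rfl⟩
      exact Submodule.mem_iSup_of_mem _ (Submodule.subset_span ⟨k, r, ⟨hr, rfl⟩, rfl⟩)
    · refine iSup_le fun e => Submodule.span_mono ?_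
      rintro _ ⟨k, r, ⟨hr, _⟩, rfl⟩
      exact ⟨k, r, hr, rfl⟩
  have hqe : q (bideg m k N)
      = Submodule.span ℂ ((fun r : expo k N => word m k r.1) '' {r | IsBad n r.1}) := by
    simp only [q]
    congr 1
    ext w
    constructor
    · rintro ⟨k', r, ⟨hr, h⟩, rfl⟩
      obtain ⟨rfl, hN⟩ := bideg_injective hm h
      exact ⟨⟨r, mem_expo.mpr hN⟩, hr, rfl⟩
    · rintro ⟨r, hr, rfl⟩
      exact ⟨k, r.1, ⟨hr, by rw [mem_expo.mp r.2]⟩, rfl⟩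
  rw [hsup, ← hqe, ← inf_iSup_eq_of_iSupIndep (iSupIndep_bidegree m) hq (bideg m k N),
    Submodule.mem_inf, and_iff_right hx]

theorem wordComb_eq_zero_iff {m : ℕ} (hm : 1 ≤ m) (n k N : ℕ) (c : expo k N → ℂ) :
    wordComb m n k N c = 0 ↔ ∑ r, c r • fockWord m k r.1
      ∈ Submodule.span ℂ ((fun r : expo k N => fockWord m k r.1) '' {r | IsBad n r.1}) := by
  set j : ℤ := (m : ℤ) - 1 + 2 * m * k with hj
  have h1 : wordComb m n k N c = (coinvariantKernel m n).mkQ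
      (∑ r, c r • ⟨word m k r.1, word_mem_V m k r.1⟩) := by
    rw [wordComb, Fintype.linearCombination_apply, map_sum]
    simp only [map_smul]
    rfl
  have h2 : ((∑ r : expo k N, c r • (⟨word m k r.1, word_mem_V m k r.1⟩ : V m) : V m) : Total)
      = incl j (∑ r, c r • fockWord m k r.1) := by
    rw [map_sum, Submodule.coe_sum]
    simp only [map_smul]
    rfl
  have h3 : incl j (∑ r, c r • fockWord m k r.1) ∈ bidegree m (bideg m k N) := by
    rw [map_sum]
    refine Submodule.sum_mem _ fun r _ => ?_
    have h := word_mem_bidegree hm k r.1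
    rw [mem_expo.mp r.2] at h
    rw [map_smul]
    exact Submodule.smul_mem _ _ h
  have h4 : (fun r : expo k N => word m k r.1) '' {r | IsBad n r.1}
      = incl j '' ((fun r : expo k N => fockWord m k r.1) '' {r | IsBad n r.1}) := by
    rw [Set.image_image]
    rfl
  rw [h1, Submodule.mkQ_apply, Submodule.Quotient.mk_eq_zero, coinvariantKernel,
    Submodule.mem_comap, Submodule.subtype_apply, h2, mem_iSup_map_a_iff hm n k N h3, h4,
    ← Submodule.map_span, Submodule.mem_map]
  constructor
  · rintro ⟨y, hy, h⟩
    rwa [← incl_injective j h]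
  · exact fun h => ⟨_, h, rfl⟩

/-- The dimensions of the graded components of the coinvariants. -/
theorem finrank_coinvPiece_bideg {m : ℕ} (hm : 1 ≤ m) (n k N : ℕ) :
    Module.finrank ℂ (coinvPiece m n (bideg m k N)) = if m * (k * (k - 1)) ≤ N
      then #(monoFuns k (n - 2 * m * (k - 1)) (N - m * (k * (k - 1)))) else 0 := by
  rw [coinvPiece_bideg hm, ← finrank_symMultiples_inf]
  exact finrank_range_eq_of_relations _ _ _ (sum_smul_fockWord_eq_zero_iff_symMultiples hm) _
    (wordComb_eq_zero_iff hm n k N)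

theorem finite_coinvPiece {m : ℕ} (hm : 1 ≤ m) (n : ℕ) (e : ℂ × ℂ) :
    Module.Finite ℂ (coinvPiece m n e) := by
  by_cases h : ∃ k N, bideg m k N = e
  · obtain ⟨k, N, rfl⟩ := h
    rw [coinvPiece_bideg hm]
    infer_instance
  · push Not at h
    rw [coinvPiece_eq_bot hm n h]
    infer_instance

/-! ### The character formula -/

/-- Reconciles the integer upper entry with truncated subtraction: if 2m(k-1) exceeds n and k ≥ 1,
both sides are 0. -/
theorem qBinomInt_eq {m : ℕ} (hm : 1 ≤ m) (n k : ℕ) :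
    qBinomInt ((n : ℤ) - (2 * m - 1) * ((k : ℤ) - 1)) k = qBinom (n - 2 * m * (k - 1) + k - 1) k := by
  cases k with
  | zero =>
    rw [qBinomInt, if_neg (by push_cast; omega), qBinom, qBinom]
  | succ k =>
    have h1 : (n : ℤ) - (2 * m - 1) * (((k + 1 : ℕ) : ℤ) - 1) = n - (2 * m * k : ℕ) + k := by
      push_cast
      ring
    rw [h1, Nat.add_sub_cancel, qBinomInt]
    by_cases h : 2 * m * k ≤ n
    · rw [if_neg (by omega)]
      congr 1
      omega
    · have h2 : qBinom (n - 2 * m * k + (k + 1) - 1) (k + 1) = 0 := qBinom_of_lt _ _ (by omega)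
      rw [h2]
      split_ifs
      · rfl
      · exact qBinom_of_lt _ _ (by omega)

theorem qBinom_eq_zero_of_large {m : ℕ} (hm : 1 ≤ m) {n k : ℕ} (hk : n + 2 ≤ k) :
    qBinom (n - 2 * m * (k - 1) + k - 1) k = 0 := by
  refine qBinom_of_lt _ _ ?_
  have : k - 1 ≤ 2 * m * (k - 1) := Nat.le_mul_of_pos_left _ (by omega)
  omega

/-- The contribution of the words of length `k` to the character. -/
def chTerm (m n k : ℕ) : CharRing :=
  ∑ D ∈ range ((qBinom (n - 2 * m * (k - 1) + k - 1) k).natDegree + 1),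
    AddMonoidAlgebra.single (bideg m k (D + m * (k * (k - 1))))
      ((qBinom (n - 2 * m * (k - 1) + k - 1) k).coeff D)

theorem chFormula_eq_sum {m : ℕ} (hm : 1 ≤ m) (n : ℕ) :
    chFormula m n = zq (degZ m (1 - m)) (degQ m (1 - m)) *
      ∑ k ∈ range (n + 2), zq (k * sqrtTwo m) (m * (k : ℂ) ^ 2) *
        Polynomial.aeval (zq 0 1) (qBinom (n - 2 * m * (k - 1) + k - 1) k) := by
  rw [chFormula]
  congr 1
  simp only [qBinomInt_eq hm]
  refine finsum_eq_sum_of_support_subset _ fun k hk => ?_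
  by_contra h
  refine hk ?_
  simp only [coe_range, Set.mem_Iio, not_lt] at h
  simp only [qBinom_eq_zero_of_large hm h, map_zero, mul_zero]

theorem zq_mul_zq_mul_aeval (m n k : ℕ) :
    zq (degZ m (1 - m)) (degQ m (1 - m)) * (zq (k * sqrtTwo m) (m * (k : ℂ) ^ 2) *
      Polynomial.aeval (zq 0 1) (qBinom (n - 2 * m * (k - 1) + k - 1) k)) = chTerm m n k := by
  rw [Polynomial.aeval_eq_sum_range, Finset.mul_sum, Finset.mul_sum, chTerm]
  refine Finset.sum_congr rfl fun D _ => ?_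
  rw [zq, zq, zq, AddMonoidAlgebra.single_pow, mul_smul_comm, mul_smul_comm,
    AddMonoidAlgebra.single_mul_single, AddMonoidAlgebra.single_mul_single,
    AddMonoidAlgebra.smul_single]
  congr 1
  · rw [bideg]
    ext
    · simp
    · simp only [Prod.snd_add, nsmul_eq_mul]
      -- The identity mk² + D = mk + (D + mk(k-1)), split by cases because k-1 is truncated at k =
      -- 0.
      cases k with
      | zero => simp
      | succ k => push_cast; simp; ring
  · simp

theorem coeff_chTerm {m : ℕ} (hm : 1 ≤ m) (n k k' N : ℕ) :
    (chTerm m n k).coeff (bideg m k' N) = if k = k' then if m * (k * (k - 1)) ≤ N then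
      (qBinom (n - 2 * m * (k - 1) + k - 1) k).coeff (N - m * (k * (k - 1))) else 0 else 0 := by
  classical
  rw [chTerm, AddMonoidAlgebra.coeff_sum, Finsupp.finsetSum_apply]
  simp only [AddMonoidAlgebra.coeff_single, Finsupp.single_apply]
  have h1 : ∀ D, bideg m k (D + m * (k * (k - 1))) = bideg m k' N ↔
      k = k' ∧ D + m * (k * (k - 1)) = N := fun D =>
    ⟨fun h => bideg_injective hm h, fun h => by rw [h.2, h.1]⟩
  simp only [h1]
  split_ifs with hk hN
  · subst hk
    obtain ⟨D, rfl⟩ := Nat.exists_eq_add_of_le' hN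
    simp only [true_and, add_left_inj, Nat.add_sub_cancel]
    rw [Finset.sum_ite_eq']
    split_ifs with hD
    · rfl
    · rw [Polynomial.coeff_eq_zero_of_natDegree_lt]
      simpa [Nat.lt_succ_iff] using hD
  · exact Finset.sum_eq_zero fun D _ => if_neg fun h => hN (by omega)
  · exact Finset.sum_eq_zero fun D _ => if_neg fun h => hk h.1

theorem coeff_chTerm_of_ne (m n k : ℕ) {e : ℂ × ℂ} (he : ∀ k N, bideg m k N ≠ e) :
    (chTerm m n k).coeff e = 0 := by
  classical
  rw [chTerm, AddMonoidAlgebra.coeff_sum, Finsupp.finsetSum_apply]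
  refine Finset.sum_eq_zero fun D _ => ?_
  rw [AddMonoidAlgebra.coeff_single, Finsupp.single_apply, if_neg (he _ _)]

theorem ch_eq {m : ℕ} (hm : 1 ≤ m) (n : ℕ) : ch m n = ⇑(chFormula m n).coeff := by
  funext e
  rw [chFormula_eq_sum hm, Finset.mul_sum]
  simp only [zq_mul_zq_mul_aeval]
  rw [AddMonoidAlgebra.coeff_sum, Finsupp.finsetSum_apply, ch]
  by_cases h : ∃ k N, bideg m k N = e
  · obtain ⟨k, N, rfl⟩ := h
    rw [finrank_coinvPiece_bideg hm]
    simp only [coeff_chTerm hm]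
    rw [Finset.sum_ite_eq']
    split_ifs with hN hk hk
    · exact card_monoFuns _ _ _
    · rw [card_monoFuns, qBinom_eq_zero_of_large hm (by simpa using hk), Polynomial.coeff_zero]
    · rfl
    · rfl
  · push Not at h
    rw [coinvPiece_eq_bot hm n h, finrank_bot]
    simp only [coeff_chTerm_of_ne m n _ h]
    simp

/-! ### The dimension -/

/-- The character formula has finite support, so all but finitely many of the finite-dimensional
pieces vanish. -/
theorem finite_coinv_and_finrank {m : ℕ} (hm : 1 ≤ m) (n : ℕ) :
    Module.Finite ℂ (Coinv m n) ∧ (Module.finrank ℂ (Coinv m n) : ℤ)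
      = ∑ e ∈ (chFormula m n).coeff.support, (chFormula m n).coeff e := by
  classical
  set T := (chFormula m n).coeff.support with hT
  have hfin : ∀ e, Module.Finite ℂ (coinvPiece m n e) := finite_coinvPiece hm n
  have hbot : ∀ e ∉ T, coinvPiece m n e = ⊥ := by
    intro e he
    rw [hT, Finsupp.mem_support_iff, not_not, ← ch_eq hm, ch, Nat.cast_eq_zero] at he
    exact Submodule.finrank_eq_zero.mp he
  have hsup : ⨆ e : T, coinvPiece m n e = ⊤ := by
    rw [eq_top_iff, ← iSup_coinvPiece hm n]
    refine iSup_le fun e => ?_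
    by_cases he : e ∈ T
    · exact le_iSup (fun e : T => coinvPiece m n e) ⟨e, he⟩
    · rw [hbot e he]
      exact bot_le
  have hint : DirectSum.IsInternal fun e : T => coinvPiece m n e :=
    DirectSum.isInternal_submodule_of_iSupIndep_of_iSup_eq_top
      ((iSupIndep_coinvPiece hm n).comp Subtype.val_injective) hsup
  let φ := LinearEquiv.ofBijective (DirectSum.coeLinearMap fun e : T => coinvPiece m n e) hint
  refine ⟨Module.Finite.equiv φ, ?_⟩
  rw [← φ.finrank_eq, Module.finrank_directSum, Nat.cast_sum, ← Finset.sum_coe_sort T]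
  refine Finset.sum_congr rfl fun e _ => ?_
  rw [← ch_eq hm, ch]

theorem eval_one_qBinom (N k : ℕ) : (qBinom N k).eval 1 = (N.choose k : ℤ) := by
  induction N generalizing k with
  | zero => cases k <;> simp [qBinom]
  | succ N ih =>
    cases k with
    | zero => simp [qBinom]
    | succ k => simp [qBinom, ih, Nat.choose_succ_succ]

theorem sum_coeff_chFormula {m : ℕ} (hm : 1 ≤ m) (n : ℕ) :
    ∑ e ∈ (chFormula m n).coeff.support, (chFormula m n).coeff e
      = ((∑ k ∈ range (n + 2), (n - 2 * m * (k - 1) + k - 1).choose k : ℕ) : ℤ) := by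
  -- The specialization z = q = 1, which sums the coefficients.
  let ε : CharRing →ₐ[ℤ] ℤ := AddMonoidAlgebra.lift ℤ ℤ (ℂ × ℂ) 1
  have h1 : ∀ x : CharRing, ε x = ∑ e ∈ x.coeff.support, x.coeff e := by
    intro x
    simp [ε, AddMonoidAlgebra.lift_apply, Finsupp.sum]
  have h2 : ∀ x y, ε (zq x y) = 1 := by
    intro x y
    simp [ε, zq, AddMonoidAlgebra.lift_single]
  rw [← h1, chFormula_eq_sum hm, map_mul, map_sum, h2, one_mul, Nat.cast_sum]
  refine Finset.sum_congr rfl fun k _ => ?_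
  rw [map_mul, h2, one_mul, ← Polynomial.aeval_algHom_apply, h2, ← eval_one_qBinom,
    Polynomial.coe_aeval_eq_eval]

/-- Pascal's rule term by term: the (k+1)-st term for n+M is the (k+1)-st for n+M-1 plus the k-th
for n. When n < M, only k = 0 and k = 1 contribute, giving 1 + n. -/
theorem sum_choose_eq_F {M : ℕ} (hM : 1 ≤ M) (n K : ℕ) (hK : n + 2 ≤ K) :
    ∑ k ∈ range K, (n - M * (k - 1) + k - 1).choose k = F M n := by
  have hlarge : ∀ n k, n < M * (k - 1) + 1 → 2 ≤ k → (n - M * (k - 1) + k - 1).choose k = 0 := by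
    intro n k h hk
    exact Nat.choose_eq_zero_of_lt (by omega)
  induction n using Nat.strong_induction_on generalizing K with
  | _ n ih =>
    by_cases hn : n < M
    · rw [F_init M n hn]
      obtain ⟨K, rfl⟩ := Nat.exists_eq_add_of_le' (show 2 ≤ K by omega)
      rw [Finset.sum_range_succ', Finset.sum_range_succ', Finset.sum_eq_zero]
      · simp
      · intro k _
        refine hlarge n _ ?_ (by omega)
        have : M ≤ M * (k + 1 + 1 - 1) := Nat.le_mul_of_pos_right _ (by omega)
        omega
    · obtain ⟨n, rfl⟩ := Nat.exists_eq_add_of_le' (show M ≤ n by omega)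
      obtain ⟨K, rfl⟩ := Nat.exists_eq_add_of_le' (show 1 ≤ K by omega)
      rw [F_add M n hM, ← ih (n + M - 1) (by omega) (K + 1) (by omega),
        ← ih n (by omega) K (by omega), Finset.sum_range_succ', Finset.sum_range_succ' _ K,
        add_right_comm, ← Finset.sum_add_distrib]
      congr 1
      · refine Finset.sum_congr rfl fun k _ => ?_
        cases k with
        | zero => simp; omega
        | succ k =>
          have h1 : M * (k + 1 + 1 - 1) = M * k + M := by rw [Nat.add_sub_cancel]; ring
          rw [h1, Nat.add_sub_add_right, Nat.add_sub_cancel]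
          -- Pascal's rule needs the subtractions to be exact; otherwise all three binomials vanish.
          by_cases hx : M * k < n
          · obtain ⟨x, rfl⟩ := Nat.exists_eq_add_of_lt hx
            have e1 : M * k + x + 1 - M * k + (k + 1 + 1) - 1 = (x + (k + 1)) + 1 := by omega
            have e2 : M * k + x + 1 + M - 1 - (M * k + M) + (k + 1 + 1) - 1 = x + (k + 1) := by omega
            have e3 : M * k + x + 1 - M * k + (k + 1) - 1 = x + (k + 1) := by omega
            rw [e1, e2, e3, Nat.choose_succ_succ, add_comm]
          · rw [Nat.choose_eq_zero_of_lt, Nat.choose_eq_zero_of_lt, Nat.choose_eq_zero_of_lt] <;> omega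
      · simp

theorem finrank_coinv {m : ℕ} (hm : 1 ≤ m) (n : ℕ) :
    Module.finrank ℂ (Coinv m n) = F (2 * m) n := by
  have h := (finite_coinv_and_finrank hm n).2
  rw [sum_coeff_chFormula hm, sum_choose_eq_F (by omega) n _ le_rfl] at h
  exact_mod_cast h

end LatticeVertex

end

theorem mainTheorem7 (m n : ℕ) (hm : 1 ≤ m) :
    (Module.Finite ℂ (LatticeVertex.Coinv m n) ∧
      Module.finrank ℂ (LatticeVertex.Coinv m n) = LatticeVertex.F (2 * m) n) ∧
    DirectSum.IsInternal (LatticeVertex.coinvPiece m n) ∧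
    LatticeVertex.ch m n = ⇑(LatticeVertex.chFormula m n).coeff :=
  ⟨⟨(LatticeVertex.finite_coinv_and_finrank hm n).1, LatticeVertex.finrank_coinv hm n⟩,
    LatticeVertex.isInternal_coinvPiece hm n, LatticeVertex.ch_eq hm n⟩
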